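/- **Setting.** Let $d\in\{2,3\}$, let $\Omega\subset\mathbb{R}^d$ be a bounded domain (nonempty, open, connected), and let $\epsilon>0$; $H_\epsilon(\mathbf{x})$ is the ball of radius $\epsilon$ about $\mathbf{x}$ and $\omega_d$ the volume of the unit ball. Let $J:\mathbb{R}\to[0,\infty)$ be bounded and measurable with $J>0$ on $(0,1)$ and $J=0$ on $(1,\infty)$. Let $g:\mathbb{R}\to\mathbb{R}$ be three times differentiable with $g,g',g'',g'''$ bounded, $g(0)=0$, $g(r)>0$ for $r\neq0$, finite limits at $\pm\infty$, $\max|g''|=g''(0)$, and, for some $r^e<0<r^c$, $g$ convex on $[r^e,r^c]$ with $g''>0$ on $(r^e,r^c)$, and $g$ concave on $(-\infty,r^e]$ and on $[r^c,\infty)$. For $\mathbf{x}\ne\mathbf{y}$ put $\mathbf{e}_{\mathbf{y}-\mathbf{x}}=\frac{\mathbf{y}-\mathbf{x}}{|\mathbf{y}-\mathbf{x}|}$ and $S(\mathbf{y},\mathbf{x},\mathbf{u})=\frac{\mathbf{u}(\mathbf{y})-\mathbf{u}(\mathbf{x})}{|\mathbf{y}-\mathbf{x}|}\cdot\mathbf{e}_{\mathbf{y}-\mathbf{x}}$.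 On $L^\infty(\Omega;\mathbb{R}^d)$ with the norm $\|\mathbf u\|_\infty=\operatorname{ess\,sup}_\Omega|\mathbf u|$ define $$\mathcal{L}[\mathbf{u}](\mathbf{x})=-\int_{H_\epsilon(\mathbf{x})\cap\Omega}\frac{2J(|\mathbf{y}-\mathbf{x}|/\epsilon)}{\epsilon^{d+1}\omega_d\sqrt{|\mathbf{y}-\mathbf{x}|}}\,g'\!\left(\sqrt{|\mathbf{y}-\mathbf{x}|}\,S(\mathbf{y},\mathbf{x},\mathbf{u})\right)\mathbf{e}_{\mathbf{y}-\mathbf{x}}\,d\mathbf{y},$$ and, for a load $\mathbf{b}_0$, $$E[\mathbf{u}]=\int_\Omega\int_{H_\epsilon(\mathbf{x})\cap\Omega}\frac{J(|\mathbf{y}-\mathbf{x}|/\epsilon)}{\epsilon^{d+1}\omega_d}\,g\!\left(\sqrt{|\mathbf{y}-\mathbf{x}|}\,S(\mathbf{y},\mathbf{x},\mathbf{u})\right)d\mathbf{y}\,d\mathbf{x}-\int_\Omega\mathbf{u}\cdot\mathbf{b}_0\,d\mathbf{x}.$$ A critical point of $E$ is a $\mathbf{u}\in L^\infty(\Omega;\mathbb{R}^d)$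 at which the Fréchet derivative of $E$ exists and vanishes. Let $\mathcal{V}$ be the space of all $\mathbf{u}\in L^\infty(\Omega;\mathbb{R}^d)$ with $\int_\Omega\mathbf{u}\cdot\mathbf{w}\,d\mathbf{x}=0$ for every rigid motion $\mathbf{w}(\mathbf{x})=\mathbf{Q}\mathbf{x}+\mathbf{c}$, $\mathbf{Q}^T=-\mathbf{Q}$. The strength domain consists of the $\mathbf{u}\in L^\infty(\Omega;\mathbb{R}^d)$ with $\sqrt{|\mathbf{y}-\mathbf{x}|}\,S(\mathbf{y},\mathbf{x},\mathbf{u})\in(r^e,r^c)$ for a.e. $(\mathbf{x},\mathbf{y})\in\Omega\times\Omega$ with $|\mathbf{y}-\mathbf{x}|<\epsilon$; $\mathbf{u}$ lies strictly inside it if these values lie, for a.e. such pair, in one closed interval contained in $(r^e,r^c)$. Let $B(\mathbf{v},R)$ be the closed $\|\cdot\|_\infty$-ball. $\Omega$ satisfies the interior cone condition if there are $\lambda>0$ and $\theta\in(0,\pi/2)$ such that every $\mathbf{x}\in\Omega$ is the apex of a spherical cone of radius $\lambda$ and aperture angle $2\theta$ contained in $\Omega$. **Theorem.** Suppose that $\Omega$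 satisfies the interior cone condition, that $\mathbf{u}_0,\mathbf{b}_0\in\mathcal{V}$, and that $\mathbf{u}_0$ lies strictly inside the strength domain and is a critical point of $E$ for the load $\mathbf{b}_0$. Then $\mathcal{L}:L^\infty(\Omega;\mathbb{R}^d)\to L^\infty(\Omega;\mathbb{R}^d)$ is Fréchet differentiable at $\mathbf{u}_0$, its derivative $D(\mathcal{L})[\mathbf{u}_0]$ maps $\mathcal{V}$ bijectively onto $\mathcal{V}$ with a bounded inverse $D(\mathcal{L})[\mathbf{u}_0]^{-1}$ on $\mathcal{V}$, of operator norm $|||D(\mathcal{L})[\mathbf{u}_0]^{-1}|||$, and there is $R_0>0$ such that for every $R\in(0,R_0]$ the following holds. 1. For every $T\ge0$ and every continuous load path $\mathbf{b}:[0,T]\to\mathcal{V}$ with $\mathbf{b}(t)\in B\!\left(\mathbf{b}_0,\frac{R}{2|||D(\mathcal{L})[\mathbf{u}_0]^{-1}|||}\right)$ for all $t$, there is a unique continuous path $\mathbf{u}:[0,T]\to\mathcal{V}$ with $\mathbf{u}(t)\in B(\mathbf{u}_0,R)$ and $\mathcal{L}[\mathbf{u}(t)]=\mathbf{b}(t)$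 for all $t\in[0,T]$. 2. $\mathbf{u}_0$ is the only critical point of $E$ (for the load $\mathbf{b}_0$) among the $\mathbf{u}\in\mathcal{V}\cap B(\mathbf{u}_0,R)$ in the strength domain. 3. $E[\mathbf{u}]\ge E[\mathbf{u}_0]$ for every $\mathbf{u}\in B(\mathbf{u}_0,R)$ in the strength domain, and equality holds for such a $\mathbf{u}\in\mathcal{V}$ only if $\mathbf{u}=\mathbf{u}_0$. -/

import Mathlib

open MeasureTheory Set Filter Topology
open scoped ENNReal RealInnerProductSpace

noncomputable section

/-- `d`-dimensional Euclidean space. -/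
abbrev Vec (d : ℕ) : Type := EuclideanSpace ℝ (Fin d)

/-- The data of the cohesive bond-based peridynamic model: a bounded domain `Ω` in `ℝ²` or `ℝ³`,
a horizon `ε`, an influence function `J` and a force potential `g` which is convex between the
critical strains `re < 0 < rc` and concave outside. -/
structure CohesiveBody (d : ℕ) where
  dim : d = 2 ∨ d = 3
  Ω : Set (Vec d)
  isOpen_Ω : IsOpen Ω
  isConnected_Ω : IsConnected Ω
  isBounded_Ω : Bornology.IsBounded Ω
  ε : ℝ
  ε_pos : 0 < ε
  J : ℝ → ℝ
  J_measurable : Measurable J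
  J_nonneg : ∀ r, 0 ≤ J r
  J_bounded : ∃ C, ∀ r, J r ≤ C
  J_pos : ∀ r, 0 < r → r < 1 → 0 < J r
  J_zero : ∀ r, 1 < r → J r = 0
  g : ℝ → ℝ
  g_diff : ∀ k < 3, Differentiable ℝ (iteratedDeriv k g)
  g_bounded : ∀ k ≤ 3, ∃ C, ∀ r, |iteratedDeriv k g r| ≤ C
  g_zero : g 0 = 0
  g_pos : ∀ r, r ≠ 0 → 0 < g r
  re : ℝ
  rc : ℝ
  re_neg : re < 0
  rc_pos : 0 < rc
  g_convex : ConvexOn ℝ (Icc re rc) g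
  g_deriv2_pos : ∀ r, re < r → r < rc → 0 < iteratedDeriv 2 g r
  g_concave_left : ConcaveOn ℝ (Iic re) g
  g_concave_right : ConcaveOn ℝ (Ici rc) g
  g_lim_bot : ∃ C, Tendsto g atBot (𝓝 C)
  g_lim_top : ∃ C, Tendsto g atTop (𝓝 C)
  g_deriv2_max : ∀ r, |iteratedDeriv 2 g r| ≤ iteratedDeriv 2 g 0

/-- The unit vector `e_{y-x}`. -/
def bondDir {d : ℕ} (y x : Vec d) : Vec d := ‖y - x‖⁻¹ • (y - x)

/-- The nonlocal strain `S(y, x, u)`. -/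
def bondStrain {d : ℕ} (y x : Vec d) (u : Vec d → Vec d) : ℝ :=
  ⟪‖y - x‖⁻¹ • (u y - u x), bondDir y x⟫

/-- The finite spherical cone with apex `x`, axis `e` (a unit vector), radius `l` and aperture
angle `2 * θ`. -/
def finiteCone {d : ℕ} (x e : Vec d) (l θ : ℝ) : Set (Vec d) :=
  {y | ‖y - x‖ ≤ l ∧ ‖y - x‖ * Real.cos θ ≤ ⟪y - x, e⟫}

/-- The interior cone condition: every point of `Ω` is the apex of a cone contained in `Ω`, with
radius and aperture angle independent of the point. -/
def InteriorConeCondition {d : ℕ} (Ω : Set (Vec d)) : Prop :=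
  ∃ θ l : ℝ, 0 < θ ∧ θ < Real.pi / 2 ∧ 0 < l ∧
    ∀ x ∈ Ω, ∃ e : Vec d, ‖e‖ = 1 ∧ finiteCone x e l θ ⊆ Ω

/-- The rigid motions `x ↦ Q x + c` with `Q` skew-symmetric. -/
def rigidMotions (d : ℕ) : Set (Vec d → Vec d) :=
  {w | ∃ (Q : Matrix (Fin d) (Fin d) ℝ) (c : Vec d), Q.transpose = -Q ∧
    w = fun x => Matrix.toEuclideanLin Q x + c}

namespace CohesiveBody

variable {d : ℕ} (M : CohesiveBody d)

/-- Lebesgue measure on `Ω`. -/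
def μ : Measure (Vec d) := volume.restrict M.Ω

instance : IsFiniteMeasure M.μ :=
  ⟨by rw [μ, Measure.restrict_apply_univ]; exact M.isBounded_Ω.measure_lt_top⟩

/-- The space `L^∞(Ω; ℝ^d)` with the essential supremum norm. -/
abbrev Linf : Type := Lp (Vec d) ∞ M.μ

/-- The volume of the unit ball of `ℝ^d`. -/
def ω (_M : CohesiveBody d) : ℝ := (volume (Metric.ball (0 : Vec d) 1)).toReal

/-- The integrand of the peridynamic force operator at `x`. -/
def forceKernel (u : Vec d → Vec d) (x y : Vec d) : Vec d :=
  (2 * M.J (‖y - x‖ / M.ε) / (M.ε ^ (d + 1) * M.ω * √‖y - x‖) *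
    deriv M.g (√‖y - x‖ * bondStrain y x u)) • bondDir y x

/-- The peridynamic force `𝓛[u](x)` as a function of the point `x`. -/
def force (u : Vec d → Vec d) (x : Vec d) : Vec d :=
  -∫ y in Metric.ball x M.ε ∩ M.Ω, M.forceKernel u x y

theorem measurable_forceKernel {u : Vec d → Vec d} (hu : Measurable u) :
    Measurable (fun p : Vec d × Vec d => M.forceKernel u p.1 p.2) := by
  have hJ := M.J_measurable
  have hg : Measurable (deriv M.g) := measurable_deriv M.g
  unfold forceKernel bondStrain bondDir
  fun_prop

theorem integrable_bound (K : ℝ) :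
    Integrable (fun z : Vec d => (Metric.ball (0 : Vec d) M.ε).indicator
      (fun z => K / √‖z‖) z) := by
  have hd : 2 ≤ d := by rcases M.dim with h | h <;> omega
  have : Nontrivial (Vec d) := by
    apply Module.nontrivial_of_finrank_pos (R := ℝ)
    rw [finrank_euclideanSpace_fin]; omega
  rw [integrable_indicator_iff Metric.isOpen_ball.measurableSet]
  have := (integrableOn_fun_norm_addHaar (volume : Measure (Vec d))
    (f := fun y : ℝ => K / √y) (r := M.ε))
  rw [this, finrank_euclideanSpace_fin]
  have hc : IntegrableOn (fun y : ℝ => K * (y ^ (d - 2) * √y)) (Ioo 0 M.ε) := by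
    refine IntegrableOn.mono_set (t := Icc 0 M.ε) ?_ Ioo_subset_Icc_self
    exact (by fun_prop : Continuous fun y : ℝ => K * (y ^ (d - 2) * √y)).integrableOn_Icc
  refine hc.congr_fun (fun y hy => ?_) measurableSet_Ioo
  have hy0 : 0 < √y := Real.sqrt_pos.2 hy.1
  have h2 : d - 1 = (d - 2) + 1 := by omega
  have hs : y = √y * √y := (Real.mul_self_sqrt hy.1.le).symm
  simp only [smul_eq_mul]
  rw [h2, pow_succ]
  field_simp
  rw [Real.sq_sqrt hy.1.le]

theorem norm_bondDir_le {y x : Vec d} : ‖bondDir y x‖ ≤ 1 := by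
  unfold bondDir
  rw [norm_smul, norm_inv, norm_norm]
  exact inv_mul_le_one

theorem exists_forceKernel_bound : ∃ K : ℝ, ∀ (u : Vec d → Vec d) (x y : Vec d),
    ‖M.forceKernel u x y‖ ≤ K / √‖y - x‖ := by
  obtain ⟨CJ, hCJ⟩ := M.J_bounded
  obtain ⟨Cg, hCg⟩ := M.g_bounded 1 (by norm_num)
  have hCJ0 : 0 ≤ CJ := (M.J_nonneg 0).trans (hCJ 0)
  have hω : 0 ≤ M.ω := ENNReal.toReal_nonneg
  have hε : 0 ≤ M.ε ^ (d + 1) := (pow_pos M.ε_pos _).le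
  refine ⟨2 * CJ / (M.ε ^ (d + 1) * M.ω) * Cg, fun u x y => ?_⟩
  unfold forceKernel
  rw [norm_smul, norm_mul]
  have h1 : ‖2 * M.J (‖y - x‖ / M.ε) / (M.ε ^ (d + 1) * M.ω * √‖y - x‖)‖
      ≤ 2 * CJ / (M.ε ^ (d + 1) * M.ω * √‖y - x‖) := by
    have := M.J_nonneg (‖y - x‖ / M.ε)
    rw [Real.norm_of_nonneg (by positivity)]
    have := hCJ (‖y - x‖ / M.ε)
    gcongr
  have h2 : ‖deriv M.g (√‖y - x‖ * bondStrain y x u)‖ ≤ Cg := by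
    have := hCg (√‖y - x‖ * bondStrain y x u)
    rwa [iteratedDeriv_one] at this
  calc _ ≤ 2 * CJ / (M.ε ^ (d + 1) * M.ω * √‖y - x‖) * Cg * 1 := by
        have hCg0 : 0 ≤ Cg := (norm_nonneg _).trans h2
        have := M.J_nonneg 0
        exact mul_le_mul (mul_le_mul h1 h2 (norm_nonneg _) (by positivity)) norm_bondDir_le
          (norm_nonneg _) (by positivity)
    _ = _ := by rw [mul_one, div_mul_eq_div_div, div_mul_eq_mul_div]

/-- The force of a displacement in `L^∞` is again in `L^∞`. -/
theorem memLp_force {u : Vec d → Vec d} (hu : Measurable u) : MemLp (M.force u) ∞ M.μ := by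
  obtain ⟨K, hK⟩ := M.exists_forceKernel_bound
  set S : Set (Vec d × Vec d) := {p | dist p.2 p.1 < M.ε} with hS
  have hSm : MeasurableSet S := measurableSet_lt (by fun_prop) measurable_const
  have hm : Measurable (S.indicator fun p : Vec d × Vec d => M.forceKernel u p.1 p.2) :=
    (M.measurable_forceKernel hu).indicator hSm
  have heq : M.force u = fun x => -∫ y, S.indicator (fun p => M.forceKernel u p.1 p.2) (x, y)
      ∂M.μ := by
    funext x
    unfold force
    rw [← Measure.restrict_restrict Metric.isOpen_ball.measurableSet,
      ← integral_indicator Metric.isOpen_ball.measurableSet]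
    rfl
  have hsm : StronglyMeasurable (M.force u) := by
    rw [heq]
    exact (StronglyMeasurable.integral_prod_right (ν := M.μ)
      (f := fun x y => S.indicator (fun p => M.forceKernel u p.1 p.2) (x, y))
      hm.stronglyMeasurable).neg
  have hint := M.integrable_bound K
  refine memLp_top_of_bound hsm.aestronglyMeasurable
    (∫ z, (Metric.ball (0 : Vec d) M.ε).indicator (fun z => K / √‖z‖) z) (ae_of_all _ fun x => ?_)
  have hpt : ∀ y, ‖S.indicator (fun p => M.forceKernel u p.1 p.2) (x, y)‖ ≤
      (Metric.ball (0 : Vec d) M.ε).indicator (fun z => K / √‖z‖) (y - x) := by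
    intro y
    by_cases h : dist y x < M.ε
    · rw [indicator_of_mem (by simpa [hS] using h),
        indicator_of_mem (by simpa [dist_eq_norm] using h)]
      exact hK u x y
    · rw [indicator_of_notMem (by simpa [hS] using h),
        indicator_of_notMem (by simpa [dist_eq_norm] using h), norm_zero]
  have hnn : ∀ y, 0 ≤ (Metric.ball (0 : Vec d) M.ε).indicator (fun z => K / √‖z‖) (y - x) :=
    fun y => (norm_nonneg _).trans (hpt y)
  have hint' := hint.comp_sub_right x
  rw [heq]
  simp only [norm_neg]
  calc _ ≤ ∫ y, (Metric.ball (0 : Vec d) M.ε).indicator (fun z => K / √‖z‖) (y - x) ∂M.μ :=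
        norm_integral_le_of_norm_le hint'.restrict (ae_of_all _ hpt)
    _ ≤ ∫ y, (Metric.ball (0 : Vec d) M.ε).indicator (fun z => K / √‖z‖) (y - x) :=
        setIntegral_le_integral hint' (ae_of_all _ hnn)
    _ = _ := integral_sub_right_eq_self _ x

/-- The peridynamic force operator on `L^∞(Ω; ℝ^d)`. -/
def L (u : M.Linf) : M.Linf := (M.memLp_force (Lp.stronglyMeasurable u).measurable).toLp

theorem integrable_inner_rigid (u : M.Linf) {w : Vec d → Vec d} (hw : w ∈ rigidMotions d) :
    Integrable (fun x => ⟪u x, w x⟫) M.μ := by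
  obtain ⟨Q, c, -, rfl⟩ := hw
  have hc : Continuous fun x : Vec d => Matrix.toEuclideanLin Q x + c :=
    (LinearMap.continuous_of_finiteDimensional _).add continuous_const
  obtain ⟨C, hC⟩ := (M.isBounded_Ω.isCompact_closure.image hc).isBounded.exists_norm_le
  have hw : MemLp (fun x : Vec d => Matrix.toEuclideanLin Q x + c) 2 M.μ := by
    refine MemLp.of_bound hc.aestronglyMeasurable C ?_
    refine (ae_restrict_mem M.isOpen_Ω.measurableSet).mono fun x hx => ?_
    exact hC _ ⟨x, subset_closure hx, rfl⟩
  have hu : MemLp u 2 M.μ := (Lp.memLp u).mono_exponent le_top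
  refine (hu.norm.integrable_mul hw.norm).mono (hu.1.inner hw.1) (ae_of_all _ fun x => ?_)
  simpa using abs_real_inner_le_norm (u x) (Matrix.toEuclideanLin Q x + c)

/-- The space `𝓥` of displacements in `L^∞(Ω; ℝ^d)` that are orthogonal to all rigid motions. -/
def V : Submodule ℝ M.Linf where
  carrier := {u | ∀ w ∈ rigidMotions d, ∫ x, ⟪u x, w x⟫ ∂M.μ = 0}
  zero_mem' := by
    intro w _
    refine integral_eq_zero_of_ae ?_
    filter_upwards [Lp.coeFn_zero (Vec d) ∞ M.μ] with x hx
    change ⟪(0 : M.Linf) x, w x⟫ = 0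
    rw [hx, Pi.zero_apply, inner_zero_left]
  add_mem' := by
    intro u v hu hv w hw
    have : (fun x => ⟪(u + v) x, w x⟫) =ᵐ[M.μ] fun x => ⟪u x, w x⟫ + ⟪v x, w x⟫ := by
      filter_upwards [Lp.coeFn_add u v] with x hx
      rw [hx, Pi.add_apply, inner_add_left]
    rw [integral_congr_ae this, integral_add (M.integrable_inner_rigid u hw)
      (M.integrable_inner_rigid v hw), hu w hw, hv w hw, add_zero]
  smul_mem' := by
    intro c u hu w hw
    have : (fun x => ⟪(c • u) x, w x⟫) =ᵐ[M.μ] fun x => c * ⟪u x, w x⟫ := by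
      filter_upwards [Lp.coeFn_smul c u] with x hx
      rw [hx, Pi.smul_apply, real_inner_smul_left]
    rw [integral_congr_ae this, integral_const_mul, hu w hw, mul_zero]

/-- The nonlocal potential `W(S(y, x, u))` of the bond between `x` and `y`. -/
def potential (u : Vec d → Vec d) (x y : Vec d) : ℝ :=
  M.J (‖y - x‖ / M.ε) / (M.ε ^ (d + 1) * M.ω * ‖y - x‖) *
    M.g (√‖y - x‖ * bondStrain y x u)

/-- The peridynamic potential energy. -/
def PD (u : M.Linf) : ℝ :=
  ∫ x in M.Ω, ∫ y in Metric.ball x M.ε ∩ M.Ω, ‖y - x‖ * M.potential u x y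

/-- The total energy under the load `b`. -/
def E (b u : M.Linf) : ℝ := M.PD u - ∫ x in M.Ω, ⟪u x, b x⟫

/-- `u` is a critical point of the total energy under the load `b`: the Fréchet derivative of the
energy on `L^∞(Ω; ℝ^d)` exists and vanishes at `u`. -/
def IsCriticalPoint (b u : M.Linf) : Prop :=
  HasFDerivAt (M.E b) (0 : M.Linf →L[ℝ] ℝ) u

/-- The strength domain: displacements all of whose scaled bond strains lie in `(re, rc)`. -/
def strengthDomain : Set M.Linf :=
  {u | ∀ᵐ p ∂(M.μ.prod M.μ), dist p.2 p.1 < M.ε →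
    √‖p.2 - p.1‖ * bondStrain p.2 p.1 u ∈ Ioo M.re M.rc}

/-- `u` lies strictly inside the strength domain: all scaled bond strains lie in one closed
interval contained in `(re, rc)`. -/
def StrictlyInsideStrengthDomain (u : M.Linf) : Prop :=
  ∃ r₁ r₂ : ℝ, M.re < r₁ ∧ r₂ < M.rc ∧
    ∀ᵐ p ∂(M.μ.prod M.μ), dist p.2 p.1 < M.ε →
      √‖p.2 - p.1‖ * bondStrain p.2 p.1 u ∈ Icc r₁ r₂

end CohesiveBody

end

/-
The linearization of the force operator at `u₀` is multiplication by the stiffness field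
`x ↦ ∫ y, M.stiffness u₀ (x, u₀ x) y` minus an integral operator whose kernel depends continuously,
as an element of `L¹`, on a parameter in a compact set. Strictly inside the strength domain `g''` is
bounded below by a positive constant, and by the interior cone condition the bonds at every point
fill a cone of directions of fixed aperture, so the stiffness field is uniformly elliptic and the
multiplication invertible; the integral operator is compact. By the Fredholm alternative it remains
to see that the linearization is injective on `V`: its quadratic form vanishes only on displacements
of zero strain, and these are rigid motions. The load paths are then lifted by the quantitative
inverse function theorem, since `g''` is Lipschitz.

The energy is its affine approximation at a critical point plus the integral over all bonds of the
excess of `g` over a tangent line. Convexity makes this excess nonnegative on the strength domain,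
and it vanishes identically only if the two displacements have the same strain.
-/

section FunctionalAnalysis

open scoped NNReal

theorem existsUnique_lift_of_approximatesLinearOn {E F Z : Type*} [NormedAddCommGroup E]
    [NormedSpace ℝ E] [CompleteSpace E] [NormedAddCommGroup F] [NormedSpace ℝ F]
    [TopologicalSpace Z] {f : E → F} {A : E ≃L[ℝ] F} {a : E} {R : ℝ} {c : ℝ≥0} (hR : 0 ≤ R)
    (hc : c * ‖(A.symm : F →L[ℝ] E)‖₊ ≤ 1 / 2)
    (hf : ApproximatesLinearOn f (A : E →L[ℝ] F) (Metric.closedBall a R) c) (b : C(Z, F))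
    (hb : ∀ t, b t ∈ Metric.closedBall (f a) (R / (2 * ‖(A.symm : F →L[ℝ] E)‖))) :
    ∃! u : C(Z, E), (∀ t, u t ∈ Metric.closedBall a R) ∧ ∀ t, f (u t) = b t := by
  have hc' : Subsingleton E ∨ c < ‖(A.symm : F →L[ℝ] E)‖₊⁻¹ :=
    A.subsingleton_or_nnnorm_symm_pos.imp_right fun hpos =>
      (NNReal.lt_inv_iff_mul_lt hpos.ne').2 (hc.trans_lt (NNReal.half_lt_self one_ne_zero))
  have hsurj : ∀ t, b t ∈ f '' Metric.closedBall a R := fun t => by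
    rcases A.subsingleton_or_norm_symm_pos with hE | hpos
    · have : Subsingleton F := A.symm.toEquiv.subsingleton
      exact ⟨a, Metric.mem_closedBall_self hR, Subsingleton.elim _ _⟩
    · refine hf.surjOn_closedBall_of_nonlinearRightInverse A.toNonlinearRightInverse hR subset_rfl
        (Metric.closedBall_subset_closedBall ?_ (hb t))
      have hcN : (c : ℝ) ≤ 1 / 2 / ‖(A.symm : F →L[ℝ] E)‖ := by
        rw [le_div_iff₀ hpos]; exact_mod_cast hc
      calc R / (2 * ‖(A.symm : F →L[ℝ] E)‖)
          = (‖(A.symm : F →L[ℝ] E)‖⁻¹ - 1 / 2 / ‖(A.symm : F →L[ℝ] E)‖) * R := by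
            field_simp; ring
        _ ≤ (‖(A.symm : F →L[ℝ] E)‖⁻¹ - c) * R := by gcongr
  let φ := hf.toPartialEquiv hc'
  refine ⟨⟨fun t => φ.symm (b t), (hf.inverse_continuousOn hc').comp_continuous b.continuous hsurj⟩,
    ⟨fun t => φ.map_target (hsurj t), fun t => φ.right_inv (hsurj t)⟩, fun v hv => ?_⟩
  ext t
  exact hf.injOn hc' (hv.1 t) (φ.map_target (hsurj t))
    ((hv.2 t).trans (φ.right_inv (hsurj t)).symm)

variable {X : Type*} [NormedAddCommGroup X] [NormedSpace ℝ X]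

theorem bijective_sub_of_isCompactOperator [CompleteSpace X] {A K : X →L[ℝ] X} (hA : IsUnit A)
    (hK : IsCompactOperator K) (hinj : ∀ x, (A - K) x = 0 → x = 0) :
    Function.Bijective (A - K) := by
  obtain ⟨U, rfl⟩ := hA
  have hfactor : (U : X →L[ℝ] X) - K = U * (1 - ↑U⁻¹ * K) := by
    rw [mul_sub, mul_one, Units.mul_inv_cancel_left]
  have hcompact : IsCompactOperator (↑U⁻¹ * K : X →L[ℝ] X) := hK.clm_comp (↑U⁻¹ : X →L[ℝ] X)
  rcases hcompact.hasEigenvalue_or_mem_resolventSet one_ne_zero with h | h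
  · obtain ⟨x, hx⟩ := h.exists_hasEigenvector
    have hfix : (↑U⁻¹ * K : X →L[ℝ] X) x = x := by simpa using hx.apply_eq_smul
    refine absurd (hinj x ?_) hx.2
    rw [hfactor, mul_apply_eq_comp, sub_apply, hfix, one_apply_eq_self, sub_self, map_zero]
  · rw [spectrum.mem_resolventSet_iff, map_one] at h
    rw [hfactor]
    exact ContinuousLinearMap.isUnit_iff_bijective.1 (U.isUnit.mul h)

/- The operator is `w ↦ ∑ i, B (e i) w • e i` for a basis `e` of `N`, so that `B w (P w)` is a sum
of squares. -/
theorem exists_isCompactOperator_detecting_orthogonal {B : X →L[ℝ] X →L[ℝ] ℝ}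
    (hB : ∀ u v, B u v = B v u) (N : Submodule ℝ X) [FiniteDimensional ℝ N] :
    ∃ P : X →L[ℝ] X, IsCompactOperator P ∧ (∀ w, P w ∈ N) ∧ (∀ w, 0 ≤ B w (P w)) ∧
      ∀ w, B w (P w) = 0 → ∀ n ∈ N, B n w = 0 := by
  let e := Module.finBasis ℝ N
  let P : X →L[ℝ] N := ∑ i, (B (e i)).smulRight (e i)
  have hP : ∀ w, B w (P w) = ∑ i, B (e i) w ^ 2 := fun w => by
    simp [P, hB w, sq]
  refine ⟨N.subtypeL ∘L P, (isCompactOperator_of_locallyCompactSpace_rng N.subtypeL).comp_clm P,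
    fun w => (P w).2, fun w => ?_, fun w hw n hn => ?_⟩
  · exact (hP w).symm ▸ Finset.sum_nonneg fun i _ => sq_nonneg _
  · have hzero : ∀ i, B (e i) w = 0 := fun i => pow_eq_zero_iff two_ne_zero |>.1 <|
      (Finset.sum_eq_zero_iff_of_nonneg fun i _ => sq_nonneg _).1 ((hP w).symm.trans hw) i
        (Finset.mem_univ i)
    rw [show n = ((∑ i, e.repr ⟨n, hn⟩ i • e i : N) : X) by rw [e.sum_repr]]
    simp only [Submodule.coe_sum, Submodule.coe_smul, map_sum, map_smul, sum_apply, smul_apply,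
      hzero, smul_zero, Finset.sum_const_zero]

theorem exists_continuousLinearEquiv_of_isCompactOperator [CompleteSpace X]
    {B : X →L[ℝ] X →L[ℝ] ℝ} (hB : ∀ u v, B u v = B v u) (hdef : ∀ u, B u u = 0 → u = 0)
    {N V : Submodule ℝ X} [FiniteDimensional ℝ N] [CompleteSpace V]
    (hV : ∀ u, u ∈ V ↔ ∀ n ∈ N, B n u = 0) {A K : X →L[ℝ] X} (hA : IsUnit A)
    (hK : IsCompactOperator K) (hmaps : ∀ w, (A - K) w ∈ V)
    (hnonneg : ∀ w, 0 ≤ B w ((A - K) w)) (hpos : ∀ w ∈ V, B w ((A - K) w) = 0 → w = 0) :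
    ∃ S : V ≃L[ℝ] V, ∀ w : V, (S w : X) = (A - K) w := by
  obtain ⟨P, hPc, hPN, hPnonneg, hPzero⟩ := exists_isCompactOperator_detecting_orthogonal hB N
  have hbij : Function.Bijective (A - (K - P)) := by
    refine bijective_sub_of_isCompactOperator hA (hK.sub hPc) fun w hw => ?_
    have hsum : B w ((A - K) w) + B w (P w) = 0 := by
      rw [← map_add, ← add_apply, sub_add, hw, map_zero]
    obtain ⟨hT0, hP0⟩ := (add_eq_zero_iff_of_nonneg (hnonneg w) (hPnonneg w)).1 hsum
    exact hpos w ((hV w).2 (hPzero w hP0)) hT0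
  let T : V →L[ℝ] V := ((A - K).comp V.subtypeL).codRestrict V fun w => hmaps w
  have hinj : LinearMap.ker (T : V →ₗ[ℝ] V) = ⊥ := LinearMap.ker_eq_bot'.2 fun w hw =>
    Subtype.ext (hpos w w.2 (by
      rw [show (A - K) w = 0 from congrArg Subtype.val hw, map_zero]))
  have hsurj : LinearMap.range (T : V →ₗ[ℝ] V) = ⊤ := LinearMap.range_eq_top.2 fun v => by
    obtain ⟨w, hw⟩ := hbij.2 v
    have hsplit : (A - K) w + P w = v := by rw [← hw, ← sub_add]; rfl
    have hPV : P w ∈ V := by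
      rw [eq_sub_of_add_eq' hsplit]; exact V.sub_mem v.2 (hmaps w)
    have hPw : P w = 0 := hdef _ ((hV _).1 hPV _ (hPN w))
    have hwV : w ∈ V := (hV w).2 (hPzero w (by rw [hPw, map_zero]))
    exact ⟨⟨w, hwV⟩, Subtype.ext ((add_zero _).symm.trans (hPw ▸ hsplit))⟩
  exact ⟨ContinuousLinearEquiv.ofBijective T hinj hsurj, fun w => rfl⟩

end FunctionalAnalysis

section Rigidity

theorem affineMap_eq_of_ae_eq {E F : Type*} [NormedAddCommGroup E] [NormedSpace ℝ E]
    [FiniteDimensional ℝ E] [MeasurableSpace E] {μ : Measure E} [μ.IsOpenPosMeasure]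
    [NormedAddCommGroup F] [NormedSpace ℝ F] {f g : E →ᵃ[ℝ] F} {U : Set E} (hU : IsOpen U)
    (hne : U.Nonempty) (h : f =ᵐ[μ.restrict U] g) : f = g :=
  AffineMap.ext_on (hU.affineSpan_eq_top hne) <| Measure.eqOn_open_of_ae_eq h hU
    f.continuous_of_finiteDimensional.continuousOn g.continuous_of_finiteDimensional.continuousOn

theorem submodule_eq_top_of_ae_sub_mem {E : Type*} [NormedAddCommGroup E] [NormedSpace ℝ E]
    [FiniteDimensional ℝ E] [MeasurableSpace E] [BorelSpace E] {μ ν : Measure E}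
    [μ.IsAddHaarMeasure] [NeZero ν] (hν : ν ≪ μ) {S : Submodule ℝ E} {x₀ : E}
    (h : ∀ᵐ x ∂ν, x - x₀ ∈ S) : S = ⊤ := by
  by_contra hS
  have hnull : μ (AffineSubspace.mk' x₀ S : Set E) = 0 :=
    Measure.addHaar_affineSubspace μ _ fun htop => hS <| by
      rw [← AffineSubspace.direction_mk' x₀ S, htop, AffineSubspace.direction_top]
  obtain ⟨x, hx, hx'⟩ := (h.and (measure_eq_zero_iff_ae_notMem.1 (hν hnull))).exists
  exact hx' (AffineSubspace.mem_mk'.2 hx)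

/-- The vectors in whose direction the component of `w` is `ν`-almost everywhere equal to an affine
function. It is used to show that a strain-free displacement is affine. -/
def affineComponents {E : Type*} [NormedAddCommGroup E] [InnerProductSpace ℝ E]
    [MeasurableSpace E] (ν : Measure E) (w : E → E) : Submodule ℝ E where
  carrier := {v | ∃ φ : E →ᵃ[ℝ] ℝ, ∀ᵐ y ∂ν, ⟪v, w y⟫ = φ y}
  zero_mem' := ⟨0, by simp⟩
  add_mem' := by
    rintro v v' ⟨φ, hφ⟩ ⟨ψ, hψ⟩
    refine ⟨φ + ψ, ?_⟩
    filter_upwards [hφ, hψ] with y hy hy'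
    simp [inner_add_left, hy, hy']
  smul_mem' := by
    rintro c v ⟨φ, hφ⟩
    refine ⟨c • φ, ?_⟩
    filter_upwards [hφ] with y hy
    simp [real_inner_smul_left, hy]

variable {E : Type*} [NormedAddCommGroup E] [InnerProductSpace ℝ E] [FiniteDimensional ℝ E]
  [MeasurableSpace E] {μ ν : Measure E}

theorem exists_affineMap_of_affineComponents_eq_top {w : E → E} (h : affineComponents ν w = ⊤) :
    ∃ f : E →ᵃ[ℝ] E, w =ᵐ[ν] f := by
  let e := stdOrthonormalBasis ℝ E
  have hcomp : ∀ i, ∃ φ : E →ᵃ[ℝ] ℝ, ∀ᵐ y ∂ν, ⟪e i, w y⟫ = φ y := fun i =>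
    (h ▸ Submodule.mem_top : e i ∈ affineComponents ν w)
  choose φ hφ using hcomp
  refine ⟨e.repr.symm.toAffineEquiv.toAffineMap.comp <|
    (WithLp.linearEquiv 2 ℝ _).symm.toAffineMap.comp (AffineMap.pi φ), ?_⟩
  filter_upwards [ae_all_iff.2 hφ] with y hy
  refine e.repr.injective ?_
  ext i
  simp [e.repr_apply_apply, hy]

theorem inner_linear_self_eq_zero_of_ae [μ.IsOpenPosMeasure] {f : E →ᵃ[ℝ] E} {U : Set E}
    (hU : IsOpen U) {x : E} (hx : x ∈ U) (h : ∀ᵐ y ∂μ.restrict U, ⟪f y - f x, y - x⟫ = 0) (v : E) :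
    ⟪f.linear v, v⟫ = 0 := by
  have hf := f.continuous_of_finiteDimensional
  have hzero : EqOn (fun y => ⟪f y - f x, y - x⟫) 0 U :=
    Measure.eqOn_open_of_ae_eq h hU (by fun_prop) continuousOn_const
  have hline : ∀ᶠ t : ℝ in 𝓝[≠] 0, x + t • v ∈ U :=
    nhdsWithin_le_nhds <| (by fun_prop : Continuous fun t : ℝ => x + t • v).continuousAt
      (hU.mem_nhds (by simpa using hx))
  obtain ⟨t, htU, ht⟩ := (hline.and self_mem_nhdsWithin).exists
  have hsq : ⟪f (x + t • v) - f x, x + t • v - x⟫ = t * (t * ⟪f.linear v, v⟫) := by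
    rw [← vsub_eq_sub (f _), ← f.linearMap_vsub, vsub_eq_sub, add_sub_cancel_left, map_smul,
      real_inner_smul_left, real_inner_smul_right]
  simpa [show t ≠ 0 from ht] using hsq.symm.trans (hzero htU)

variable [BorelSpace E]

theorem exists_affineMap_of_ae_inner_eq_zero [μ.IsAddHaarMeasure] [NeZero ν] (hν : ν ≪ μ)
    {w : E → E} (h : ∀ᵐ x ∂ν, ∀ᵐ y ∂ν, ⟪w y - w x, y - x⟫ = 0) :
    ∃ f : E →ᵃ[ℝ] E, w =ᵐ[ν] f := by
  obtain ⟨x₀, hx₀⟩ := h.exists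
  refine exists_affineMap_of_affineComponents_eq_top <| submodule_eq_top_of_ae_sub_mem hν
    (x₀ := x₀) ?_
  filter_upwards [h] with x hx
  let φ (a : E) : E →ᵃ[ℝ] ℝ :=
    (innerₛₗ ℝ (w a)).toAffineMap.comp (AffineMap.id ℝ E - AffineMap.const ℝ E a)
  refine ⟨φ x₀ - φ x, ?_⟩
  filter_upwards [hx₀, hx] with y hy₀ hy
  have hφ : ∀ a, φ a y = ⟪w a, y - a⟫ := fun a => rfl
  rw [AffineMap.coe_sub, Pi.sub_apply, hφ, hφ, real_inner_comm]
  rw [inner_sub_left, sub_eq_zero] at hy hy₀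
  rw [← hy, ← hy₀, ← inner_sub_right, sub_sub_sub_cancel_left]

theorem exists_affineMap_of_locally [μ.IsOpenPosMeasure] {Ω : Set E} (hΩ : IsOpen Ω)
    (hc : IsConnected Ω) {w : E → E}
    (h : ∀ x ∈ Ω, ∃ U, IsOpen U ∧ x ∈ U ∧ ∃ f : E →ᵃ[ℝ] E, w =ᵐ[μ.restrict U] f) :
    ∃ f : E →ᵃ[ℝ] E, w =ᵐ[μ.restrict Ω] f := by
  choose! U hU hxU f hf using h
  obtain ⟨x₀, hx₀⟩ := hc.nonempty
  have hloc : ∀ x ∈ Ω, ∀ᶠ y in 𝓝[Ω] x, f x = f y := fun x hx => by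
    filter_upwards [self_mem_nhdsWithin, mem_nhdsWithin_of_mem_nhds ((hU x hx).mem_nhds (hxU x hx))]
      with y hy hyx
    refine affineMap_eq_of_ae_eq (μ := μ) ((hU x hx).inter (hU y hy)) ⟨y, hyx, hxU y hy⟩ ?_
    filter_upwards [ae_restrict_of_ae_restrict_of_subset inter_subset_left (hf x hx),
      ae_restrict_of_ae_restrict_of_subset inter_subset_right (hf y hy)] with a hax hay
    exact hax.symm.trans hay
  have hconst : ∀ x ∈ Ω, f x₀ = f x := fun x hx =>
    hc.isPreconnected.induction₂ (fun a b => f a = f b) hloc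
      (fun _ _ _ _ _ _ hab hbc => hab.trans hbc) (fun _ _ _ _ hab => hab.symm) hx₀ hx
  refine ⟨f x₀, (ae_restrict_iff' hΩ.measurableSet).2 ?_⟩
  refine measure_null_of_locally_null _ fun x hx => ?_
  have hxΩ : x ∈ Ω := (Classical.not_imp.1 hx).1
  refine ⟨_, inter_mem_nhdsWithin _ ((hU x hxΩ).mem_nhds (hxU x hxΩ)), ?_⟩
  refine measure_mono_null ?_ (ae_imp_of_ae_restrict (hf x hxΩ))
  rintro y ⟨hy, hyU⟩ hyf
  exact hy fun _ => (hyf hyU).trans (by rw [hconst x hxΩ])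

theorem exists_rigid_of_ae_inner_eq_zero [μ.IsAddHaarMeasure] {Ω : Set E} (hΩ : IsOpen Ω)
    (hc : IsConnected Ω) {r : ℝ} (hr : 0 < r) {w : E → E}
    (h : ∀ᵐ x ∂μ.restrict Ω, ∀ᵐ y ∂μ.restrict Ω, dist y x < r → ⟪w y - w x, y - x⟫ = 0) :
    ∃ (A : E →ₗ[ℝ] E) (c : E), (∀ v, ⟪A v, v⟫ = 0) ∧ w =ᵐ[μ.restrict Ω] fun x => A x + c := by
  obtain ⟨f, hf⟩ : ∃ f : E →ᵃ[ℝ] E, w =ᵐ[μ.restrict Ω] f := by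
    refine exists_affineMap_of_locally hΩ hc fun x hx => ?_
    let U := Ω ∩ Metric.ball x (r / 2)
    have hU : IsOpen U := hΩ.inter Metric.isOpen_ball
    have hxU : x ∈ U := ⟨hx, Metric.mem_ball_self (half_pos hr)⟩
    have : NeZero (μ.restrict U) :=
      ⟨mt Measure.restrict_eq_zero.1 (hU.measure_pos μ ⟨x, hxU⟩).ne'⟩
    refine ⟨U, hU, hxU, exists_affineMap_of_ae_inner_eq_zero Measure.absolutelyContinuous_restrict
      ?_⟩
    filter_upwards [ae_restrict_of_ae_restrict_of_subset inter_subset_left h,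
      ae_restrict_mem hU.measurableSet] with a ha haU
    filter_upwards [ae_restrict_of_ae_restrict_of_subset inter_subset_left ha,
      ae_restrict_mem hU.measurableSet] with b hb hbU
    exact hb (by linarith [dist_triangle_right b a x, Metric.mem_ball.1 haU.2,
      Metric.mem_ball.1 hbU.2])
  have : NeZero (μ.restrict Ω) :=
    ⟨mt Measure.restrict_eq_zero.1 (hΩ.measure_pos μ hc.nonempty).ne'⟩
  obtain ⟨x, hx, hfx, hxΩ⟩ := (h.and (hf.and (ae_restrict_mem hΩ.measurableSet))).exists
  refine ⟨f.linear, f 0, fun v => ?_, hf.trans (.of_eq f.decomp)⟩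
  refine inner_linear_self_eq_zero_of_ae (hΩ.inter Metric.isOpen_ball)
    (x := x) ⟨hxΩ, Metric.mem_ball_self hr⟩ (μ := μ) ?_ v
  filter_upwards [ae_restrict_of_ae_restrict_of_subset inter_subset_left hx,
    ae_restrict_of_ae_restrict_of_subset inter_subset_left hf,
    ae_restrict_mem (hΩ.inter Metric.isOpen_ball).measurableSet] with y hy hfy hyU
  rw [← hfx, ← hfy]
  exact hy hyU.2

end Rigidity

section EssentiallyBounded

variable {α F : Type*} [MeasurableSpace α] {μ : Measure α} [NormedAddCommGroup F]

theorem ae_norm_le_linfty_norm (f : Lp F ∞ μ) : ∀ᵐ x ∂μ, ‖f x‖ ≤ ‖f‖ := by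
  filter_upwards [ae_le_eLpNormEssSup (f := f) (μ := μ)] with x hx
  rw [Lp.norm_def, ← toReal_enorm]
  exact ENNReal.toReal_mono (Lp.eLpNorm_ne_top f) (hx.trans_eq eLpNorm_exponent_top.symm)

theorem linfty_norm_le_of_ae_bound {f : Lp F ∞ μ} {C : ℝ} (hC : 0 ≤ C) (h : ∀ᵐ x ∂μ, ‖f x‖ ≤ C) :
    ‖f‖ ≤ C := by
  rw [Lp.norm_def, eLpNorm_exponent_top]
  exact ENNReal.toReal_le_of_le_ofReal hC (eLpNormEssSup_le_of_ae_bound h)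

variable [InnerProductSpace ℝ F]

theorem ae_norm_inner_le_linfty_norm (f g : Lp F ∞ μ) : ∀ᵐ x ∂μ, ‖⟪f x, g x⟫‖ ≤ ‖f‖ * ‖g‖ := by
  filter_upwards [ae_norm_le_linfty_norm f, ae_norm_le_linfty_norm g] with x hf hg
  exact (norm_inner_le_norm _ _).trans (by gcongr)

variable [IsFiniteMeasure μ]

theorem integrable_inner_linfty (f g : Lp F ∞ μ) : Integrable (fun x => ⟪f x, g x⟫) μ :=
  .of_bound ((Lp.aestronglyMeasurable f).inner (Lp.aestronglyMeasurable g)) _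
    (ae_norm_inner_le_linfty_norm f g)

/-- The `L²` inner product of two elements of `L^∞` of a finite measure, as a bounded bilinear form
on `L^∞`. -/
noncomputable def linftyPairing : Lp F ∞ μ →L[ℝ] Lp F ∞ μ →L[ℝ] ℝ :=
  (LinearMap.mk₂ ℝ (fun f g : Lp F ∞ μ => ∫ x, ⟪f x, g x⟫ ∂μ)
    (fun f g h => by
      rw [← integral_add (integrable_inner_linfty f h) (integrable_inner_linfty g h)]
      refine integral_congr_ae ?_
      filter_upwards [Lp.coeFn_add f g] with x hx
      rw [hx, Pi.add_apply, inner_add_left])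
    (fun c f g => by
      rw [smul_eq_mul, ← integral_const_mul]
      refine integral_congr_ae ?_
      filter_upwards [Lp.coeFn_smul c f] with x hx
      rw [hx, Pi.smul_apply, real_inner_smul_left])
    (fun f g h => by
      rw [← integral_add (integrable_inner_linfty f g) (integrable_inner_linfty f h)]
      refine integral_congr_ae ?_
      filter_upwards [Lp.coeFn_add g h] with x hx
      rw [hx, Pi.add_apply, inner_add_right])
    (fun c f g => by
      rw [smul_eq_mul, ← integral_const_mul]
      refine integral_congr_ae ?_
      filter_upwards [Lp.coeFn_smul c g] with x hx
      rw [hx, Pi.smul_apply, real_inner_smul_right])).mkContinuous₂ (μ.real univ) fun f g =>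
        (norm_integral_le_of_norm_le_const (ae_norm_inner_le_linfty_norm f g)).trans_eq (by ring)

theorem linftyPairing_apply (f g : Lp F ∞ μ) : linftyPairing f g = ∫ x, ⟪f x, g x⟫ ∂μ := rfl

theorem linftyPairing_comm (f g : Lp F ∞ μ) : linftyPairing f g = linftyPairing g f := by
  simp only [linftyPairing_apply, real_inner_comm]

theorem eq_zero_of_linftyPairing_self {f : Lp F ∞ μ} (h : linftyPairing f f = 0) : f = 0 := by
  have hzero := (integral_eq_zero_iff_of_nonneg (fun x => real_inner_self_nonneg)
    (integrable_inner_linfty f f)).1 h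
  refine (Lp.eq_zero_iff_ae_eq_zero).2 ?_
  filter_upwards [hzero] with x hx
  exact inner_self_eq_zero.1 hx

end EssentiallyBounded

section MultiplicationOperators

variable {α F : Type*} [MeasurableSpace α] {μ : Measure α} [NormedAddCommGroup F]

/-- The operator `w ↦ a w` on `L^∞` given by pointwise multiplication with an essentially bounded
operator-valued function `a`. -/
noncomputable def linftyMul [NormedSpace ℝ F] (a : Lp (F →L[ℝ] F) ∞ μ) :
    Lp F ∞ μ →L[ℝ] Lp F ∞ μ :=
  (ContinuousLinearMap.id ℝ (F →L[ℝ] F)).holderL μ ∞ ∞ ∞ a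

theorem coeFn_linftyMul [NormedSpace ℝ F] (a : Lp (F →L[ℝ] F) ∞ μ) (w : Lp F ∞ μ) :
    linftyMul a w =ᵐ[μ] fun x => a x (w x) :=
  (ContinuousLinearMap.id ℝ (F →L[ℝ] F)).coeFn_holder a w

theorem isUnit_of_norm_sub_smul_le {X : Type*} [NormedAddCommGroup X] [NormedSpace ℝ X]
    [CompleteSpace X] {A : X →L[ℝ] X} {t q : ℝ} (ht : t ≠ 0) (hq0 : 0 ≤ q) (hq : q < 1)
    (h : ∀ x, ‖x - t • A x‖ ≤ q * ‖x‖) : IsUnit A := by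
  have hclose : ‖(1 : X →L[ℝ] X) - t • A‖ < 1 :=
    (ContinuousLinearMap.opNorm_le_bound _ hq0 fun x => by simpa using h x).trans_lt hq
  have hunit : IsUnit (Units.mk0 t ht • A) := by
    simpa [Units.smul_def] using isUnit_one_sub_of_norm_lt_one hclose
  exact (isUnit_smul_iff _ _).1 hunit

variable [InnerProductSpace ℝ F]

theorem norm_sub_smul_sq_le {T : F →L[ℝ] F} {v : F} {γ B : ℝ} (hγ : 0 ≤ γ)
    (hell : γ * ‖v‖ ^ 2 ≤ ⟪T v, v⟫) (hT : ‖T‖ ≤ B) (hB : 0 < B) :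
    ‖v - (γ / B ^ 2) • T v‖ ^ 2 ≤ (1 - γ ^ 2 / B ^ 2) * ‖v‖ ^ 2 := by
  have hTv : ‖T v‖ ^ 2 ≤ B ^ 2 * ‖v‖ ^ 2 := by
    rw [← mul_pow]
    gcongr
    exact T.le_of_opNorm_le hT v
  calc ‖v - (γ / B ^ 2) • T v‖ ^ 2
      = ‖v‖ ^ 2 - 2 * (γ / B ^ 2) * ⟪T v, v⟫ + (γ / B ^ 2) ^ 2 * ‖T v‖ ^ 2 := by
        rw [norm_sub_sq_real, norm_smul, real_inner_smul_right, real_inner_comm, mul_pow,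
          Real.norm_eq_abs, sq_abs]
        ring
    _ ≤ ‖v‖ ^ 2 - 2 * (γ / B ^ 2) * (γ * ‖v‖ ^ 2) + (γ / B ^ 2) ^ 2 * (B ^ 2 * ‖v‖ ^ 2) := by
        gcongr
    _ = (1 - γ ^ 2 / B ^ 2) * ‖v‖ ^ 2 := by
        field_simp
        ring

theorem isUnit_linftyMul_of_elliptic [CompleteSpace F] {a : Lp (F →L[ℝ] F) ∞ μ} {γ : ℝ}
    (hγ : 0 < γ) (hell : ∀ᵐ x ∂μ, ∀ v, γ * ‖v‖ ^ 2 ≤ ⟪a x v, v⟫) : IsUnit (linftyMul a) := by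
  set B : ℝ := ‖a‖ + γ
  have hB : 0 < B := by positivity
  have hratio : γ ^ 2 / B ^ 2 ≤ 1 := div_le_one_of_le₀
    (pow_le_pow_left₀ hγ.le (le_add_of_nonneg_left (norm_nonneg a)) 2) (sq_nonneg B)
  have hq : √(1 - γ ^ 2 / B ^ 2) < 1 := by
    rw [Real.sqrt_lt' one_pos, one_pow, sub_lt_self_iff]
    positivity
  refine isUnit_of_norm_sub_smul_le (t := γ / B ^ 2) (by positivity) (Real.sqrt_nonneg _) hq
    fun w => linfty_norm_le_of_ae_bound (by positivity) ?_
  filter_upwards [Lp.coeFn_sub w ((γ / B ^ 2) • linftyMul a w),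
    Lp.coeFn_smul (γ / B ^ 2) (linftyMul a w), coeFn_linftyMul a w, hell,
    ae_norm_le_linfty_norm a, ae_norm_le_linfty_norm w] with x hsub hsmul hmul hx ha hw
  rw [hsub, Pi.sub_apply, hsmul, Pi.smul_apply, hmul]
  calc ‖w x - (γ / B ^ 2) • a x (w x)‖ ≤ √((1 - γ ^ 2 / B ^ 2) * ‖w x‖ ^ 2) :=
        Real.le_sqrt_of_sq_le (norm_sub_smul_sq_le hγ.le (hx _)
          (ha.trans (le_add_of_nonneg_right hγ.le)) hB)
    _ = √(1 - γ ^ 2 / B ^ 2) * ‖w x‖ := by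
        rw [Real.sqrt_mul (sub_nonneg.2 hratio), Real.sqrt_sq (norm_nonneg _)]
    _ ≤ √(1 - γ ^ 2 / B ^ 2) * ‖w‖ := by gcongr

end MultiplicationOperators

section IntegralOperators

variable {α Y E F : Type*} [TopologicalSpace Y] [CompactSpace Y] [NormedAddCommGroup E]
  [NormedSpace ℝ E] [NormedAddCommGroup F] [NormedSpace ℝ F]

/-- The operator `w ↦ (y ↦ k y w)` into continuous functions, for a continuous family `k` of
operators. -/
noncomputable def applyFamily (k : C(Y, E →L[ℝ] F)) : E →L[ℝ] C(Y, F) :=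
  LinearMap.mkContinuous
    { toFun := fun w => ⟨fun y => k y w, k.continuous.clm_apply continuous_const⟩
      map_add' := fun _ _ => ContinuousMap.ext fun y => map_add (k y) _ _
      map_smul' := fun _ _ => ContinuousMap.ext fun y => map_smul (k y) _ _ } ‖k‖ fun w =>
    (ContinuousMap.norm_le _ (by positivity)).2 fun y =>
      (k y).le_of_opNorm_le (k.norm_coe_le_norm y) w

theorem isCompactOperator_applyFamily [ProperSpace F] (k : C(Y, E →L[ℝ] F)) :
    IsCompactOperator (applyFamily k) := by
  let e := ContinuousMap.linearIsometryBoundedOfCompact Y F ℝ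
  have hcpt : IsCompact (closure ((fun w => e (applyFamily k w)) '' Metric.closedBall 0 1)) := by
    refine BoundedContinuousFunction.arzela_ascoli (Metric.closedBall 0 ‖k‖)
      (isCompact_closedBall _ _) _ ?_ fun y => ?_
    · rintro _ y ⟨w, hw, rfl⟩
      rw [mem_closedBall_zero_iff] at hw ⊢
      exact (k y).le_of_opNorm_le_of_le (k.norm_coe_le_norm y) hw |>.trans_eq (mul_one _)
    · refine Metric.equicontinuousAt_of_continuity_modulus (fun y' => ‖k y - k y'‖) ?_ _ ?_
      · exact (continuous_const.sub k.continuous).norm.tendsto' _ _ (by simp)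
      · refine Eventually.of_forall fun y' => ?_
        rintro ⟨_, w, hw, rfl⟩
        rw [mem_closedBall_zero_iff] at hw
        rw [dist_eq_norm]
        exact (k y - k y').le_of_opNorm_le_of_le le_rfl hw |>.trans_eq (mul_one _)
  have hcomp : IsCompactOperator fun w => e (applyFamily k w) :=
    ⟨_, hcpt, mem_of_superset (Metric.closedBall_mem_nhds 0 one_pos) fun w hw =>
      subset_closure ⟨w, hw, rfl⟩⟩
  have := hcomp.continuous_comp e.symm.continuous
  simpa only [Function.comp_def, e.symm_apply_apply] using this

variable [MeasurableSpace α] {μ : Measure α} [MeasurableSpace Y] [BorelSpace Y]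
  [SecondCountableTopology Y] [IsFiniteMeasure μ]

/-- The operator `f ↦ f ∘ φ` from continuous functions to `L^∞`, for a measurable map `φ`. -/
noncomputable def linftyComp (E : Type*) [NormedAddCommGroup E] [NormedSpace ℝ E] {φ : α → Y}
    (hφ : Measurable φ) : C(Y, E) →L[ℝ] Lp E ∞ μ :=
  (Lp.compMeasurePreservingₗᵢ ℝ φ (hφ.measurePreserving μ)).toContinuousLinearMap ∘L
    ContinuousMap.toLp ∞ (μ.map φ) ℝ

theorem coeFn_linftyComp {φ : α → Y} (hφ : Measurable φ) (f : C(Y, E)) :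
    (linftyComp E hφ f : Lp E ∞ μ) =ᵐ[μ] fun x => f (φ x) :=
  (Lp.coeFn_compMeasurePreserving _ (hφ.measurePreserving μ)).trans
    ((hφ.measurePreserving μ).quasiMeasurePreserving.ae_eq (ContinuousMap.coeFn_toLp _ f))

theorem exists_isCompactOperator_integral [ProperSpace F]
    (Λ : C(Y, Lp (E →L[ℝ] F) 1 μ)) {φ : α → Y} (hφ : Measurable φ) :
    ∃ K : Lp E ∞ μ →L[ℝ] Lp F ∞ μ, IsCompactOperator K ∧
      ∀ w, K w =ᵐ[μ] fun x => ∫ y, Λ (φ x) y (w y) ∂μ := by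
  let P : Lp (E →L[ℝ] F) 1 μ →L[ℝ] Lp E ∞ μ →L[ℝ] F :=
    (ContinuousLinearMap.id ℝ (E →L[ℝ] F)).lpPairing μ 1 ∞
  let k : C(Y, Lp E ∞ μ →L[ℝ] F) := (P : C(_, _)).comp Λ
  refine ⟨linftyComp F hφ ∘L applyFamily k,
    (isCompactOperator_applyFamily k).clm_comp (linftyComp F hφ), fun w => ?_⟩
  filter_upwards [coeFn_linftyComp hφ (applyFamily k w)] with x hx
  rw [ContinuousLinearMap.comp_apply, hx]
  exact ContinuousLinearMap.lpPairing_eq_integral _ (Λ (φ x)) w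

end IntegralOperators

section Calculus

theorem abs_sub_sub_mul_le_of_lipschitz_deriv {φ φ' : ℝ → ℝ} {C : ℝ}
    (hφ : ∀ r, HasDerivAt φ (φ' r) r) (hφ' : ∀ r s, |φ' r - φ' s| ≤ C * |r - s|)
    {s t s₀ m : ℝ} (hs : |s - s₀| ≤ m) (ht : |t - s₀| ≤ m) :
    |φ s - φ t - φ' s₀ * (s - t)| ≤ C * m * |s - t| := by
  have hC : 0 ≤ C := by simpa using (abs_nonneg _).trans (hφ' 1 0)
  have hmean := (convex_closedBall s₀ m).norm_image_sub_le_of_norm_hasDerivWithin_le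
    (f := fun r => φ r - φ' s₀ * r) (f' := fun r => φ' r - φ' s₀ * 1) (C := C * m)
    (fun r _ => ((hφ r).sub ((hasDerivAt_id r).const_mul (φ' s₀))).hasDerivWithinAt)
    (fun r hr => by
      rw [mul_one, Real.norm_eq_abs]
      exact (hφ' r s₀).trans (by gcongr; simpa [Real.dist_eq] using hr))
    (x := t) (y := s) (by simpa [Real.dist_eq] using ht) (by simpa [Real.dist_eq] using hs)
  rw [Real.norm_eq_abs, Real.norm_eq_abs] at hmean
  convert hmean using 2
  ring

theorem add_mul_sub_lt_of_strictConvexOn {S : Set ℝ} {f : ℝ → ℝ} {x y f' : ℝ}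
    (hf : StrictConvexOn ℝ S f) (hx : x ∈ S) (hy : y ∈ S) (hne : x ≠ y)
    (hd : HasDerivAt f f' x) : f x + f' * (y - x) < f y := by
  rcases hne.lt_or_gt with h | h
  · have := hf.lt_slope_of_hasDerivAt hx hy h hd
    rw [slope_def_field, lt_div_iff₀ (sub_pos.2 h)] at this
    linarith
  · have := hf.slope_lt_of_hasDerivAt hy hx h hd
    rw [slope_def_field, div_lt_iff₀ (sub_pos.2 h)] at this
    linarith

theorem hasFDerivAt_of_norm_sub_le_sq {E F : Type*} [NormedAddCommGroup E] [NormedSpace ℝ E]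
    [NormedAddCommGroup F] [NormedSpace ℝ F] {f : E → F} {f' : E →L[ℝ] F} {x : E} {C : ℝ}
    (h : ∀ y, ‖f y - f x - f' (y - x)‖ ≤ C * ‖y - x‖ ^ 2) : HasFDerivAt f f' x := by
  refine .of_isLittleO <| (Asymptotics.IsBigO.of_bound C ?_).trans_isLittleO
    (Asymptotics.isLittleO_pow_sub_sub x one_lt_two)
  exact Eventually.of_forall fun y => by simpa using h y

end Calculus

section LOneContinuity

theorem tendsto_integral_norm_sub_translate {E F : Type*} [NormedAddCommGroup E]
    [MeasurableSpace E] [BorelSpace E] [LocallyCompactSpace E]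
    {μ : Measure E} [μ.IsAddHaarMeasure] [μ.InnerRegularCompactLTTop]
    [NormedAddCommGroup F] {f : E → F} (hf : Integrable f μ) (x : E) :
    Tendsto (fun x' => ∫ y, ‖f (y - x') - f (y - x)‖ ∂μ) (𝓝 x) (𝓝 0) := by
  let τ : C(E, C(E, E)) := ContinuousMap.curry ⟨fun p => p.2 - p.1, by fun_prop⟩
  have hτ : ∀ x, MeasurePreserving (τ x) μ μ := measurePreserving_sub_right μ
  have hlim := Filter.Tendsto.compMeasurePreservingLp
    (tendsto_const_nhds (x := (memLp_one_iff_integrable.2 hf).toLp)) (τ.continuous.tendsto x) hτ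
    (hτ x) ENNReal.one_ne_top
  rw [tendsto_iff_norm_sub_tendsto_zero] at hlim
  refine hlim.congr fun x' => ?_
  rw [Lp.toLp_compMeasurePreserving, Lp.toLp_compMeasurePreserving, ← MemLp.toLp_sub]
  exact L1.norm_of_fun_eq_integral_norm (((hf.comp_sub_right x')).sub (hf.comp_sub_right x))

variable {ι α F : Type*} [MeasurableSpace α] {μ : Measure α} [NormedAddCommGroup F]
  [NormedSpace ℝ F]

theorem tendsto_integral_norm_smul_sub {l : Filter ι} [l.IsCountablyGenerated] {i₀ : ι}
    {h : ι → α → ℝ} {T : ι → α → F} {C : ℝ} (hm : ∀ i, AEStronglyMeasurable (h i) μ)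
    (hC : ∀ i x, ‖h i x‖ ≤ C) (hT : ∀ i, Integrable (T i) μ)
    (hTlim : Tendsto (fun i => ∫ x, ‖T i x - T i₀ x‖ ∂μ) l (𝓝 0))
    (hlim : ∀ᵐ x ∂μ, Tendsto (fun i => h i x • T i₀ x) l (𝓝 (h i₀ x • T i₀ x))) :
    Tendsto (fun i => ∫ x, ‖h i x • T i x - h i₀ x • T i₀ x‖ ∂μ) l (𝓝 0) := by
  have hint : ∀ i j, Integrable (fun x => h i x • T j x) μ := fun i j =>
    (hT j).bdd_smul C (hm i) (ae_of_all _ (hC i))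
  have hfrozen : Tendsto (fun i => ∫ x, ‖h i x • T i₀ x - h i₀ x • T i₀ x‖ ∂μ) l (𝓝 0) := by
    rw [← integral_zero α ℝ (μ := μ)]
    refine tendsto_integral_filter_of_dominated_convergence (fun x => C * ‖T i₀ x‖ + C * ‖T i₀ x‖)
      (Eventually.of_forall fun i => ((hint i i₀).sub (hint i₀ i₀)).norm.1)
      (Eventually.of_forall fun i => ae_of_all _ fun x => ?_)
      (((hT i₀).norm.const_mul C).add ((hT i₀).norm.const_mul C)) ?_
    · rw [norm_norm]
      refine (norm_sub_le _ _).trans ?_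
      rw [norm_smul, norm_smul]
      gcongr <;> exact hC _ x
    · filter_upwards [hlim] with x hx
      exact tendsto_iff_norm_sub_tendsto_zero.1 hx
  refine squeeze_zero (fun i => integral_nonneg fun x => norm_nonneg _) (fun i => ?_)
    (by simpa using (hTlim.const_mul C).add hfrozen)
  have hdiff : Integrable (fun x => C * ‖T i x - T i₀ x‖) μ :=
    ((hT i).sub (hT i₀)).norm.const_mul C
  have hfro : Integrable (fun x => ‖h i x • T i₀ x - h i₀ x • T i₀ x‖) μ :=
    ((hint i i₀).sub (hint i₀ i₀)).norm
  rw [← integral_const_mul, ← integral_add hdiff hfro]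
  refine integral_mono ((hint i i).sub (hint i₀ i₀)).norm (hdiff.add hfro) fun x => ?_
  calc ‖h i x • T i x - h i₀ x • T i₀ x‖
      ≤ ‖h i x • T i x - h i x • T i₀ x‖ + ‖h i x • T i₀ x - h i₀ x • T i₀ x‖ :=
        norm_sub_le_norm_sub_add_norm_sub _ _ _
    _ ≤ C * ‖T i x - T i₀ x‖ + ‖h i x • T i₀ x - h i₀ x • T i₀ x‖ := by
        rw [← smul_sub, norm_smul]
        gcongr
        exact hC i x

end LOneContinuity

section Antisymmetry

variable {α F : Type*} [MeasurableSpace α] {μ : Measure α} [SFinite μ]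
  [NormedAddCommGroup F] [InnerProductSpace ℝ F] [CompleteSpace F]

theorem integral_inner_sub_of_antisymm {f : α × α → F} (hf : Integrable f (μ.prod μ))
    (anti : ∀ p, f p.swap = -f p) {φ : α → F} (hφ : AEStronglyMeasurable φ μ) {C : ℝ}
    (hC : ∀ᵐ x ∂μ, ‖φ x‖ ≤ C) :
    ∫ p, ⟪f p, φ p.2 - φ p.1⟫ ∂(μ.prod μ) = -2 * ∫ x, ⟪∫ y, f (x, y) ∂μ, φ x⟫ ∂μ := by
  have hfst : Integrable (fun p : α × α => ⟪f p, φ p.1⟫) (μ.prod μ) := by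
    refine (hf.norm.mul_const C).mono' (hf.1.inner hφ.comp_fst) ?_
    filter_upwards [Measure.quasiMeasurePreserving_fst.ae hC] with p hp
    exact (norm_inner_le_norm _ _).trans (by gcongr)
  have hswap : (fun p : α × α => ⟪f p, φ p.2⟫) = fun p => -(fun p => ⟪f p, φ p.1⟫) p.swap := by
    funext p
    simp only [anti p, Prod.fst_swap, inner_neg_left, neg_neg]
  have hsnd : Integrable (fun p : α × α => ⟪f p, φ p.2⟫) (μ.prod μ) := by
    rw [hswap]
    exact hfst.swap.neg
  have hsnd_eq : ∫ p, ⟪f p, φ p.2⟫ ∂(μ.prod μ) = -∫ p, ⟪f p, φ p.1⟫ ∂(μ.prod μ) := by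
    rw [hswap, integral_neg, integral_prod_swap (fun p : α × α => ⟪f p, φ p.1⟫)]
  have hfst_eq : ∫ p, ⟪f p, φ p.1⟫ ∂(μ.prod μ) = ∫ x, ⟪∫ y, f (x, y) ∂μ, φ x⟫ ∂μ := by
    rw [integral_prod _ hfst]
    refine integral_congr_ae ?_
    filter_upwards [hf.prod_right_ae] with x hx
    simp only [real_inner_comm (φ x)]
    exact integral_inner hx (φ x)
  simp only [inner_sub_right]
  rw [integral_sub hsnd hfst, hsnd_eq, hfst_eq]
  ring

end Antisymmetry

section Strain

variable {d : ℕ} {u v : Vec d → Vec d}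

theorem bondDir_swap (x y : Vec d) : bondDir x y = -bondDir y x := by
  unfold bondDir
  rw [← smul_neg, neg_sub, norm_sub_rev]

theorem measurable_bondDir : Measurable fun p : Vec d × Vec d => bondDir p.2 p.1 := by
  unfold bondDir
  fun_prop

/-- The bond strain scaled by the square root of the bond length; this is the argument of the
force potential `g`. -/
noncomputable def scaledStrain (u : Vec d → Vec d) (p : Vec d × Vec d) : ℝ :=
  √‖p.2 - p.1‖ * bondStrain p.2 p.1 u

theorem scaledStrain_eq (p : Vec d × Vec d) :
    scaledStrain u p = (√‖p.2 - p.1‖)⁻¹ * ⟪u p.2 - u p.1, bondDir p.2 p.1⟫ := by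
  unfold scaledStrain bondStrain
  rw [real_inner_smul_left, ← mul_assoc, ← div_eq_mul_inv, Real.sqrt_div_self', one_div]

theorem abs_scaledStrain_le (p : Vec d × Vec d) :
    |scaledStrain u p| ≤ (√‖p.2 - p.1‖)⁻¹ * ‖u p.2 - u p.1‖ := by
  rw [scaledStrain_eq, abs_mul, abs_of_nonneg (by positivity)]
  gcongr
  exact (abs_real_inner_le_norm _ _).trans
    (mul_le_of_le_one_right (norm_nonneg _) CohesiveBody.norm_bondDir_le)

theorem scaledStrain_swap (p : Vec d × Vec d) : scaledStrain u p.swap = scaledStrain u p := by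
  rw [scaledStrain_eq, scaledStrain_eq, Prod.fst_swap, Prod.snd_swap, bondDir_swap, norm_sub_rev,
    ← neg_sub (u p.2), inner_neg_neg]

theorem measurable_scaledStrain (hu : Measurable u) : Measurable (scaledStrain u) := by
  unfold scaledStrain bondStrain bondDir
  fun_prop

theorem scaledStrain_eq_zero_iff (p : Vec d × Vec d) :
    scaledStrain u p = 0 ↔ ⟪u p.2 - u p.1, p.2 - p.1⟫ = 0 := by
  rw [scaledStrain_eq, bondDir, real_inner_smul_right, mul_eq_zero, mul_eq_zero, inv_eq_zero,
    inv_eq_zero, Real.sqrt_eq_zero (norm_nonneg _), norm_eq_zero, ← or_assoc, or_self,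
    or_iff_right_iff_imp]
  intro h
  rw [h, inner_zero_right]

end Strain

namespace CohesiveBody

variable {d : ℕ} (M : CohesiveBody d)

section BondDensity

theorem two_le_dim {d : ℕ} (M : CohesiveBody d) : 2 ≤ d := by rcases M.dim with h | h <;> omega

theorem nontrivial_vec {d : ℕ} (M : CohesiveBody d) : Nontrivial (Vec d) := by
  apply Module.nontrivial_of_finrank_pos (R := ℝ)
  rw [finrank_euclideanSpace_fin]
  exact zero_lt_two.trans_le M.two_le_dim

theorem ω_pos : 0 < M.ω :=
  ENNReal.toReal_pos (Metric.measure_ball_pos volume _ one_pos).ne' measure_ball_lt_top.ne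

/-- The normalised influence function, as a function of the bond vector `z = y - x`. -/
noncomputable def bondDensity (z : Vec d) : ℝ :=
  (Metric.ball (0 : Vec d) M.ε).indicator (fun z => M.J (‖z‖ / M.ε) / (M.ε ^ (d + 1) * M.ω)) z

theorem bondDensity_nonneg (z : Vec d) : 0 ≤ M.bondDensity z :=
  indicator_nonneg (fun _ _ => div_nonneg (M.J_nonneg _)
    (mul_nonneg (pow_nonneg M.ε_pos.le _) M.ω_pos.le)) z

theorem measurable_bondDensity : Measurable M.bondDensity := by
  have hJ := M.J_measurable
  exact Measurable.indicator (by fun_prop) Metric.isOpen_ball.measurableSet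

theorem bondDensity_neg (z : Vec d) : M.bondDensity (-z) = M.bondDensity z := by
  simp [bondDensity, indicator]

theorem bondDensity_of_le {z : Vec d} (h : M.ε ≤ ‖z‖) : M.bondDensity z = 0 :=
  indicator_of_notMem (by simpa using h) _

theorem bondDensity_of_lt {z : Vec d} (h : ‖z‖ < M.ε) :
    M.bondDensity z = M.J (‖z‖ / M.ε) / (M.ε ^ (d + 1) * M.ω) :=
  indicator_of_mem (by simpa using h) _

theorem bondDensity_pos {z : Vec d} (h0 : z ≠ 0) (h : ‖z‖ < M.ε) : 0 < M.bondDensity z := by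
  rw [bondDensity_of_lt M h]
  have := M.ε_pos
  have := M.ω_pos
  have := M.J_pos (‖z‖ / M.ε) (div_pos (norm_pos_iff.2 h0) M.ε_pos) ((div_lt_one M.ε_pos).2 h)
  positivity

theorem exists_bondDensity_le : ∃ C, ∀ z, M.bondDensity z ≤ C := by
  obtain ⟨C, hC⟩ := M.J_bounded
  have hC0 : 0 ≤ C := (M.J_nonneg 0).trans (hC 0)
  have := M.ε_pos
  have := M.ω_pos
  refine ⟨C / (M.ε ^ (d + 1) * M.ω), fun z => ?_⟩
  exact indicator_apply_le' (fun _ => by gcongr; exact hC _) fun _ => by positivity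

end BondDensity

section BondMoment

/-- The bond density weighted by `|z|^(-k/2)`, the integrable majorant of a kernel with a
singularity of this order at vanishing bond length. -/
noncomputable def bondMoment (k : ℕ) (z : Vec d) : ℝ := M.bondDensity z * (√‖z‖)⁻¹ ^ k

theorem bondMoment_nonneg (k : ℕ) (z : Vec d) : 0 ≤ M.bondMoment k z :=
  mul_nonneg (M.bondDensity_nonneg z) (by positivity)

theorem measurable_bondMoment (k : ℕ) : Measurable (M.bondMoment k) := by
  have := M.measurable_bondDensity
  unfold bondMoment
  fun_prop

theorem bondMoment_neg (k : ℕ) (z : Vec d) : M.bondMoment k (-z) = M.bondMoment k z := by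
  rw [bondMoment, bondDensity_neg, norm_neg, bondMoment]

theorem integrableOn_inv_sqrt_norm_pow {k : ℕ} (hk : k < 2 * d) :
    IntegrableOn (fun z : Vec d => (√‖z‖)⁻¹ ^ k) (Metric.ball 0 M.ε) := by
  have := M.nontrivial_vec
  have hd := M.two_le_dim
  have hk' : (k : ℝ) < 2 * d := mod_cast hk
  rw [integrableOn_fun_norm_addHaar volume (f := fun r : ℝ => (√r)⁻¹ ^ k),
    finrank_euclideanSpace_fin]
  refine ((intervalIntegral.integrableOn_Ioo_rpow_iff M.ε_pos
    (s := (d - 1 : ℕ) - k / 2)).2 ?_).congr_fun (fun r hr => ?_) measurableSet_Ioo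
  · rw [Nat.cast_sub (by omega)]
    push_cast
    linarith
  · beta_reduce
    rw [Real.rpow_sub hr.1, Real.rpow_natCast, smul_eq_mul, inv_pow, div_eq_mul_inv,
      Real.sqrt_eq_rpow, ← Real.rpow_mul_natCast hr.1.le, one_div_mul_eq_div]

theorem integrable_bondMoment {k : ℕ} (hk : k < 2 * d) : Integrable (M.bondMoment k) := by
  obtain ⟨C, hC⟩ := M.exists_bondDensity_le
  have hball := ((integrable_indicator_iff Metric.isOpen_ball.measurableSet).2
    (M.integrableOn_inv_sqrt_norm_pow hk)).const_mul C
  refine hball.mono' (M.measurable_bondMoment k).aestronglyMeasurable (ae_of_all _ fun z => ?_)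
  rw [Real.norm_of_nonneg (M.bondMoment_nonneg k z)]
  unfold bondMoment
  by_cases hz : z ∈ Metric.ball (0 : Vec d) M.ε
  · rw [indicator_of_mem hz]
    gcongr
    exact hC z
  · rw [indicator_of_notMem hz, bondDensity, indicator_of_notMem hz, zero_mul, mul_zero]

theorem integrable_bondMoment_sub {k : ℕ} (hk : k < 2 * d) (x : Vec d) :
    Integrable (fun y => M.bondMoment k (y - x)) M.μ :=
  ((M.integrable_bondMoment hk).comp_sub_right x).restrict

theorem integral_bondMoment_sub_le {k : ℕ} (hk : k < 2 * d) (x : Vec d) :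
    ∫ y, M.bondMoment k (y - x) ∂M.μ ≤ ∫ z, M.bondMoment k z :=
  (setIntegral_le_integral ((M.integrable_bondMoment hk).comp_sub_right x)
    (ae_of_all _ fun _ => M.bondMoment_nonneg k _)).trans_eq (integral_sub_right_eq_self _ x)

theorem integrable_bondMoment_prod {k : ℕ} (hk : k < 2 * d) :
    Integrable (fun p : Vec d × Vec d => M.bondMoment k (p.2 - p.1)) (M.μ.prod M.μ) := by
  have hmeas : Measurable fun p : Vec d × Vec d => M.bondMoment k (p.2 - p.1) :=
    (M.measurable_bondMoment k).comp (by fun_prop)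
  rw [integrable_prod_iff hmeas.aestronglyMeasurable]
  refine ⟨ae_of_all _ (M.integrable_bondMoment_sub hk),
    .of_bound (hmeas.norm.stronglyMeasurable.integral_prod_right' (ν := M.μ)).aestronglyMeasurable
      (∫ z, M.bondMoment k z) (ae_of_all _ fun x => ?_)⟩
  simp only [Real.norm_of_nonneg (M.bondMoment_nonneg k _)]
  rw [Real.norm_of_nonneg (integral_nonneg fun _ => M.bondMoment_nonneg k _)]
  exact M.integral_bondMoment_sub_le hk x

end BondMoment

section BondMeasure

/-- The measure on pairs of points of `Ω` whose density is the normalised influence function of the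
bond between them, so that the peridynamic energy is `∫ g(√|y - x| S(y, x, u))` against it. -/
noncomputable def bondMeasure : Measure (Vec d × Vec d) :=
  (M.μ.prod M.μ).withDensity fun p => ENNReal.ofReal (M.bondDensity (p.2 - p.1))

theorem measurable_bondDensity_prod :
    Measurable fun p : Vec d × Vec d => M.bondDensity (p.2 - p.1) :=
  M.measurable_bondDensity.comp (by fun_prop)

theorem integral_bondMeasure (f : Vec d × Vec d → ℝ) :
    ∫ p, f p ∂M.bondMeasure = ∫ p, M.bondDensity (p.2 - p.1) * f p ∂(M.μ.prod M.μ) := by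
  rw [bondMeasure, integral_withDensity_eq_integral_toReal_smul
    M.measurable_bondDensity_prod.ennreal_ofReal (ae_of_all _ fun _ => ENNReal.ofReal_lt_top)]
  simp only [ENNReal.toReal_ofReal (M.bondDensity_nonneg _), smul_eq_mul]

theorem integrable_bondMeasure_iff {f : Vec d × Vec d → ℝ} :
    Integrable f M.bondMeasure ↔
      Integrable (fun p => M.bondDensity (p.2 - p.1) * f p) (M.μ.prod M.μ) := by
  rw [bondMeasure, integrable_withDensity_iff_integrable_smul'
    M.measurable_bondDensity_prod.ennreal_ofReal (ae_of_all _ fun _ => ENNReal.ofReal_lt_top)]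
  simp only [ENNReal.toReal_ofReal (M.bondDensity_nonneg _), smul_eq_mul]

theorem integrable_inv_sqrt_pow_bondMeasure {k : ℕ} (hk : k < 2 * d) :
    Integrable (fun p : Vec d × Vec d => (√‖p.2 - p.1‖)⁻¹ ^ k) M.bondMeasure :=
  M.integrable_bondMeasure_iff.2 (M.integrable_bondMoment_prod hk)

instance : IsFiniteMeasure M.bondMeasure := by
  have hone := M.integrable_inv_sqrt_pow_bondMeasure (k := 0)
    (mul_pos two_pos (zero_lt_two.trans_le M.two_le_dim))
  simp only [pow_zero] at hone
  exact (integrable_const_iff_isFiniteMeasure one_ne_zero).1 hone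

theorem ae_bondMeasure_of_ae {P : Vec d × Vec d → Prop} (h : ∀ᵐ p ∂(M.μ.prod M.μ), P p) :
    ∀ᵐ p ∂M.bondMeasure, P p :=
  withDensity_absolutelyContinuous _ _ h

theorem ae_bondMeasure_iff {P : Vec d × Vec d → Prop} (hdiag : ∀ x, P (x, x)) :
    (∀ᵐ p ∂M.bondMeasure, P p) ↔ ∀ᵐ p ∂(M.μ.prod M.μ), dist p.2 p.1 < M.ε → P p := by
  rw [bondMeasure, ae_withDensity_iff M.measurable_bondDensity_prod.ennreal_ofReal]
  refine eventually_congr (ae_of_all _ fun p => ?_)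
  rw [ne_eq, ENNReal.ofReal_eq_zero, not_le, dist_eq_norm]
  refine ⟨fun h hp => ?_, fun h hp => h ?_⟩
  · rcases eq_or_ne p.2 p.1 with heq | hne
    · exact (Prod.ext rfl heq : p = (p.1, p.1)) ▸ hdiag p.1
    · exact h (M.bondDensity_pos (sub_ne_zero.2 hne) hp)
  · by_contra hfar
    exact hp.ne' (M.bondDensity_of_le (not_lt.1 hfar))

theorem mem_strengthDomain_iff {u : M.Linf} :
    u ∈ M.strengthDomain ↔ ∀ᵐ p ∂M.bondMeasure, scaledStrain u p ∈ Ioo M.re M.rc :=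
  (M.ae_bondMeasure_iff fun x => by simp [M.re_neg, M.rc_pos]).symm

end BondMeasure

end CohesiveBody

namespace CohesiveBody

variable {d : ℕ} (M : CohesiveBody d)

section Potential

theorem hasDerivAt_g (r : ℝ) : HasDerivAt M.g (deriv M.g r) r := by
  have := M.g_diff 0 (by norm_num)
  rw [iteratedDeriv_zero] at this
  exact (this r).hasDerivAt

theorem hasDerivAt_deriv_g (r : ℝ) : HasDerivAt (deriv M.g) (iteratedDeriv 2 M.g r) r := by
  have := M.g_diff 1 (by norm_num)
  rw [iteratedDeriv_one] at this
  rw [iteratedDeriv_succ, iteratedDeriv_one]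
  exact (this r).hasDerivAt

theorem continuous_deriv2_g : Continuous (iteratedDeriv 2 M.g) :=
  (M.g_diff 2 (by norm_num)).continuous

theorem deriv2_g_zero_nonneg : 0 ≤ iteratedDeriv 2 M.g 0 :=
  (abs_nonneg _).trans (M.g_deriv2_max 0)

theorem abs_deriv_g_sub_le (r s : ℝ) :
    |deriv M.g r - deriv M.g s| ≤ iteratedDeriv 2 M.g 0 * |r - s| :=
  convex_univ.norm_image_sub_le_of_norm_hasDerivWithin_le
    (fun r _ => (M.hasDerivAt_deriv_g r).hasDerivWithinAt) (fun r _ => M.g_deriv2_max r)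
    (mem_univ s) (mem_univ r)

theorem exists_abs_deriv2_g_sub_le : ∃ C, 0 ≤ C ∧
    ∀ r s, |iteratedDeriv 2 M.g r - iteratedDeriv 2 M.g s| ≤ C * |r - s| := by
  obtain ⟨C, hC⟩ := M.g_bounded 3 le_rfl
  refine ⟨C, (abs_nonneg _).trans (hC 0), fun r s => ?_⟩
  refine convex_univ.norm_image_sub_le_of_norm_hasDerivWithin_le (f' := iteratedDeriv 3 M.g)
    (fun r _ => ?_) (fun r _ => hC r) (mem_univ s) (mem_univ r)
  rw [iteratedDeriv_succ (n := 2)]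
  exact (M.g_diff 2 (by norm_num) r).hasDerivAt.hasDerivWithinAt

theorem exists_abs_deriv_g_le : ∃ C, 0 ≤ C ∧ ∀ r, |deriv M.g r| ≤ C := by
  obtain ⟨C, hC⟩ := M.g_bounded 1 (by norm_num)
  rw [iteratedDeriv_one] at hC
  exact ⟨C, (abs_nonneg _).trans (hC 0), hC⟩

end Potential

section LinfStrain

variable {M}

theorem measurable_coe (u : M.Linf) : Measurable u := (Lp.stronglyMeasurable u).measurable

theorem ae_abs_scaledStrain_le (w : M.Linf) : ∀ᵐ p ∂(M.μ.prod M.μ),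
    |scaledStrain w p| ≤ 2 * ‖w‖ * (√‖p.2 - p.1‖)⁻¹ := by
  filter_upwards [Measure.quasiMeasurePreserving_fst.ae (ae_norm_le_linfty_norm w),
    Measure.quasiMeasurePreserving_snd.ae (ae_norm_le_linfty_norm w)] with p h1 h2
  refine (abs_scaledStrain_le p).trans ?_
  rw [mul_comm]
  gcongr
  exact (norm_sub_le _ _).trans (by linarith)

theorem ae_scaledStrain_sub (u v : M.Linf) : ∀ᵐ p ∂(M.μ.prod M.μ),
    scaledStrain (u - v : M.Linf) p = scaledStrain u p - scaledStrain v p := by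
  filter_upwards [Measure.quasiMeasurePreserving_fst.ae (Lp.coeFn_sub u v),
    Measure.quasiMeasurePreserving_snd.ae (Lp.coeFn_sub u v)] with p h1 h2
  rw [scaledStrain_eq, scaledStrain_eq, scaledStrain_eq, h1, h2, Pi.sub_apply, Pi.sub_apply,
    sub_sub_sub_comm, inner_sub_left, mul_sub]

theorem ae_abs_scaledStrain_sub_le {u v : M.Linf} {R : ℝ} (h : ‖u - v‖ ≤ R) :
    ∀ᵐ p ∂(M.μ.prod M.μ),
      |scaledStrain u p - scaledStrain v p| ≤ 2 * R * (√‖p.2 - p.1‖)⁻¹ := by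
  filter_upwards [ae_scaledStrain_sub u v, ae_abs_scaledStrain_le (u - v)] with p h1 h2
  rw [← h1]
  exact h2.trans (by gcongr)

end LinfStrain

section BondForce

/-- The force density that the bonds exert at `x` when the bond between `x` and `y` carries the
tension `G (x, y)`. The peridynamic force `𝓛[u]` has the tension `g'(√|y - x| S(y, x, u))`. -/
noncomputable def bondForce (G : Vec d × Vec d → ℝ) (x : Vec d) : Vec d :=
  -∫ y, (2 * (M.bondMoment 1 (y - x) * G (x, y))) • bondDir y x ∂M.μ

theorem setIntegral_ball_eq {F : Type*} [NormedAddCommGroup F] [NormedSpace ℝ F] (x : Vec d)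
    {f f' : Vec d → F} (hnear : ∀ y, ‖y - x‖ < M.ε → f y = f' y)
    (hfar : ∀ y, M.ε ≤ ‖y - x‖ → f' y = 0) :
    ∫ y in Metric.ball x M.ε ∩ M.Ω, f y = ∫ y, f' y ∂M.μ := by
  rw [← Measure.restrict_restrict Metric.isOpen_ball.measurableSet,
    ← integral_indicator Metric.isOpen_ball.measurableSet]
  refine integral_congr_ae (ae_of_all _ fun y => ?_)
  simp only [indicator, Metric.mem_ball, dist_eq_norm]
  split_ifs with h
  · exact hnear y h
  · exact (hfar y (not_lt.1 h)).symm

theorem force_eq_bondForce (u : Vec d → Vec d) :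
    M.force u = M.bondForce (deriv M.g ∘ scaledStrain u) := by
  funext x
  unfold force bondForce
  congr 1
  refine M.setIntegral_ball_eq x (fun y hy => ?_) (fun y hy => ?_)
  · rw [bondMoment, M.bondDensity_of_lt hy, pow_one]
    unfold forceKernel
    congr 1
    change _ = 2 * (_ * deriv M.g (√‖y - x‖ * bondStrain y x u))
    ring
  · rw [bondMoment, M.bondDensity_of_le hy, zero_mul, zero_mul, mul_zero, zero_smul]

variable {M}

theorem coeFn_L (u : M.Linf) : M.L u =ᵐ[M.μ] M.bondForce (deriv M.g ∘ scaledStrain u) := by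
  rw [← force_eq_bondForce]
  exact MemLp.coeFn_toLp _

variable {G H : Vec d × Vec d → ℝ} {x : Vec d} {C : ℝ} {k : ℕ}

theorem abs_bondMoment_mul_le {y : Vec d} (h : |G (x, y)| ≤ C * (√‖y - x‖)⁻¹ ^ k) :
    ‖M.bondMoment 1 (y - x) * G (x, y)‖ ≤ C * M.bondMoment (k + 1) (y - x) := by
  rw [norm_mul, Real.norm_of_nonneg (M.bondMoment_nonneg _ _), Real.norm_eq_abs]
  calc
    _ ≤ M.bondMoment 1 (y - x) * (C * (√‖y - x‖)⁻¹ ^ k) :=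
      mul_le_mul_of_nonneg_left h (M.bondMoment_nonneg _ _)
    _ = _ := by unfold bondMoment; ring

theorem integrable_bondMoment_mul (hk : k + 1 < 2 * d)
    (hG : AEStronglyMeasurable (fun y => G (x, y)) M.μ)
    (h : ∀ᵐ y ∂M.μ, |G (x, y)| ≤ C * (√‖y - x‖)⁻¹ ^ k) :
    Integrable (fun y => M.bondMoment 1 (y - x) * G (x, y)) M.μ := by
  refine ((M.integrable_bondMoment_sub hk x).const_mul C).mono' (.mul ?_ hG)
    (h.mono fun y => abs_bondMoment_mul_le)
  exact ((M.measurable_bondMoment 1).comp (by fun_prop)).aestronglyMeasurable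

theorem norm_bondForce_le (hk : k + 1 < 2 * d) (hC : 0 ≤ C)
    (h : ∀ᵐ y ∂M.μ, |G (x, y)| ≤ C * (√‖y - x‖)⁻¹ ^ k) :
    ‖M.bondForce G x‖ ≤ 2 * C * ∫ z, M.bondMoment (k + 1) z := by
  rw [bondForce, norm_neg]
  calc
    _ ≤ ∫ y, 2 * C * M.bondMoment (k + 1) (y - x) ∂M.μ := by
      refine norm_integral_le_of_norm_le ((M.integrable_bondMoment_sub hk x).const_mul _)
        (h.mono fun y hy => ?_)
      rw [norm_smul, norm_mul, Real.norm_two, mul_assoc, mul_assoc]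
      exact mul_le_mul_of_nonneg_left ((mul_le_of_le_one_right (norm_nonneg _)
        norm_bondDir_le).trans (abs_bondMoment_mul_le hy)) zero_le_two
    _ ≤ _ := by
      rw [integral_const_mul]
      gcongr
      exact M.integral_bondMoment_sub_le hk x

theorem bondForce_sub (hG : Integrable (fun y => M.bondMoment 1 (y - x) * G (x, y)) M.μ)
    (hH : Integrable (fun y => M.bondMoment 1 (y - x) * H (x, y)) M.μ) :
    M.bondForce (G - H) x = M.bondForce G x - M.bondForce H x := by
  have key : ∀ K : Vec d × Vec d → ℝ,
      Integrable (fun y => M.bondMoment 1 (y - x) * K (x, y)) M.μ →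
      Integrable (fun y => (2 * (M.bondMoment 1 (y - x) * K (x, y))) • bondDir y x) M.μ :=
    fun K hK => (hK.const_mul 2).smul_bdd 1
      (measurable_bondDir.comp measurable_prodMk_left).aestronglyMeasurable
      (ae_of_all _ fun _ => norm_bondDir_le)
  unfold bondForce
  rw [← neg_add', ← sub_eq_add_neg, ← integral_sub (key G hG) (key H hH)]
  simp only [Pi.sub_apply, mul_sub, sub_smul]

theorem linftyPairing_eq_integral_bondMeasure (hsymm : ∀ p, G p.swap = G p)
    (hG : Integrable (fun p => (√‖p.2 - p.1‖)⁻¹ * G p) M.bondMeasure) {f : M.Linf}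
    (hf : f =ᵐ[M.μ] M.bondForce G) (φ : M.Linf) :
    linftyPairing f φ = ∫ p, G p * scaledStrain φ p ∂M.bondMeasure := by
  let F : Vec d × Vec d → Vec d := fun p =>
    (2 * (M.bondMoment 1 (p.2 - p.1) * G p)) • bondDir p.2 p.1
  have hF : Integrable F (M.μ.prod M.μ) := by
    have hint : Integrable (fun p => M.bondMoment 1 (p.2 - p.1) * G p) (M.μ.prod M.μ) := by
      simpa only [bondMoment, pow_one, mul_assoc] using M.integrable_bondMeasure_iff.1 hG
    exact (hint.const_mul 2).smul_bdd 1 measurable_bondDir.aestronglyMeasurable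
      (ae_of_all _ fun _ => norm_bondDir_le)
  have hanti : ∀ p, F p.swap = -F p := fun p => by
    simp only [F, Prod.fst_swap, Prod.snd_swap]
    rw [← neg_sub, bondMoment_neg, hsymm, bondDir_swap, smul_neg]
  have hstrain : ∀ p, ⟪F p, φ p.2 - φ p.1⟫ =
      2 * (M.bondDensity (p.2 - p.1) * (G p * scaledStrain φ p)) := fun p => by
    simp only [F, bondMoment, pow_one]
    rw [real_inner_smul_left, scaledStrain_eq, real_inner_comm]
    ring
  have hpair : linftyPairing f φ = -∫ x, ⟪∫ y, F (x, y) ∂M.μ, φ x⟫ ∂M.μ := by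
    rw [linftyPairing_apply, ← integral_neg]
    refine integral_congr_ae (hf.mono fun x hx => ?_)
    beta_reduce
    rw [hx, ← inner_neg_left]
    rfl
  have := integral_inner_sub_of_antisymm hF hanti (Lp.aestronglyMeasurable φ)
    (ae_norm_le_linfty_norm φ)
  simp only [hstrain, integral_const_mul, ← integral_bondMeasure] at this
  linarith

end BondForce

end CohesiveBody

namespace CohesiveBody

variable {d : ℕ} (M : CohesiveBody d)

section Linearization

/-- The derivative, in the direction `w`, of the tension of a bond at the displacement `u`. -/
noncomputable def tensionDeriv (u w : Vec d → Vec d) (p : Vec d × Vec d) : ℝ :=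
  iteratedDeriv 2 M.g (scaledStrain u p) * scaledStrain w p

theorem tensionDeriv_swap (u w : Vec d → Vec d) (p : Vec d × Vec d) :
    M.tensionDeriv u w p.swap = M.tensionDeriv u w p := by
  rw [tensionDeriv, scaledStrain_swap, scaledStrain_swap, tensionDeriv]

theorem measurable_tensionDeriv {u w : Vec d → Vec d} (hu : Measurable u) (hw : Measurable w) :
    Measurable (M.tensionDeriv u w) :=
  (M.continuous_deriv2_g.measurable.comp (measurable_scaledStrain hu)).mul
    (measurable_scaledStrain hw)

theorem ae_abs_tensionDeriv_le (u : Vec d → Vec d) (w : M.Linf) : ∀ᵐ p ∂(M.μ.prod M.μ),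
    |M.tensionDeriv u w p| ≤ iteratedDeriv 2 M.g 0 * (2 * ‖w‖) * (√‖p.2 - p.1‖)⁻¹ ^ 1 := by
  filter_upwards [ae_abs_scaledStrain_le w] with p hp
  rw [tensionDeriv, abs_mul, pow_one, mul_assoc]
  exact mul_le_mul (M.g_deriv2_max _) hp (abs_nonneg _) M.deriv2_g_zero_nonneg

theorem ae_abs_tension_sub_sub_le {C : ℝ} (hC : 0 ≤ C)
    (hlip : ∀ r s, |iteratedDeriv 2 M.g r - iteratedDeriv 2 M.g s| ≤ C * |r - s|)
    {u₀ u v : M.Linf} {R : ℝ} (hu : ‖u - u₀‖ ≤ R) (hv : ‖v - u₀‖ ≤ R) :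
    ∀ᵐ p ∂(M.μ.prod M.μ), |(deriv M.g ∘ scaledStrain u - deriv M.g ∘ scaledStrain v -
      M.tensionDeriv u₀ (u - v : M.Linf)) p| ≤ 4 * C * R * ‖u - v‖ * (√‖p.2 - p.1‖)⁻¹ ^ 2 := by
  have hR : 0 ≤ R := (norm_nonneg _).trans hu
  filter_upwards [ae_abs_scaledStrain_sub_le hu, ae_abs_scaledStrain_sub_le hv,
    ae_abs_scaledStrain_sub_le (le_refl ‖u - v‖), ae_scaledStrain_sub u v] with p hup hvp huv heq
  simp only [Pi.sub_apply, Function.comp_apply, tensionDeriv]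
  rw [heq]
  refine (abs_sub_sub_mul_le_of_lipschitz_deriv M.hasDerivAt_deriv_g hlip hup hvp).trans ?_
  calc
    _ ≤ C * (2 * R * (√‖p.2 - p.1‖)⁻¹) * (2 * ‖u - v‖ * (√‖p.2 - p.1‖)⁻¹) := by gcongr
    _ = _ := by ring

theorem integrable_bondMoment_mul_deriv_g (u : M.Linf) (x : Vec d) :
    Integrable (fun y => M.bondMoment 1 (y - x) * (deriv M.g ∘ scaledStrain u) (x, y)) M.μ := by
  have hd := M.two_le_dim
  obtain ⟨C, -, hC⟩ := M.exists_abs_deriv_g_le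
  exact integrable_bondMoment_mul (k := 0) (C := C) (by omega)
    (((measurable_deriv M.g).comp (measurable_scaledStrain (measurable_coe u))).comp
      measurable_prodMk_left).aestronglyMeasurable (ae_of_all _ fun y => by simpa using hC _)

theorem norm_L_sub_sub_le {C : ℝ} (hC : 0 ≤ C)
    (hlip : ∀ r s, |iteratedDeriv 2 M.g r - iteratedDeriv 2 M.g s| ≤ C * |r - s|)
    {u₀ : M.Linf} {D : M.Linf →L[ℝ] M.Linf}
    (hD : ∀ w, D w =ᵐ[M.μ] M.bondForce (M.tensionDeriv u₀ w)) {R : ℝ} {u v : M.Linf}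
    (hu : ‖u - u₀‖ ≤ R) (hv : ‖v - u₀‖ ≤ R) :
    ‖M.L u - M.L v - D (u - v)‖ ≤ 8 * C * (∫ z, M.bondMoment 3 z) * R * ‖u - v‖ := by
  have hd := M.two_le_dim
  have hR : 0 ≤ R := (norm_nonneg _).trans hu
  have hmass : 0 ≤ ∫ z, M.bondMoment 3 z := integral_nonneg (M.bondMoment_nonneg 3)
  refine linfty_norm_le_of_ae_bound (by positivity) ?_
  filter_upwards [Lp.coeFn_sub (M.L u - M.L v) (D (u - v)), Lp.coeFn_sub (M.L u) (M.L v),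
    coeFn_L u, coeFn_L v, hD (u - v),
    Measure.ae_ae_of_ae_prod (M.ae_abs_tension_sub_sub_le hC hlip hu hv),
    Measure.ae_ae_of_ae_prod (M.ae_abs_tensionDeriv_le u₀ (u - v))]
    with x hsub hsub' hLu hLv hDx hrem htan
  have hlin := integrable_bondMoment_mul (by omega) ((M.measurable_tensionDeriv
    (measurable_coe u₀) (measurable_coe (u - v))).comp
      measurable_prodMk_left).aestronglyMeasurable htan
  have hu' := M.integrable_bondMoment_mul_deriv_g u x
  have hv' := M.integrable_bondMoment_mul_deriv_g v x
  have hsubint : Integrable (fun y => M.bondMoment 1 (y - x) *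
      (deriv M.g ∘ scaledStrain u - deriv M.g ∘ scaledStrain v) (x, y)) M.μ := by
    simpa only [Pi.sub_apply, mul_sub] using! hu'.sub hv'
  rw [hsub, Pi.sub_apply, hsub', Pi.sub_apply, hLu, hLv, hDx, ← bondForce_sub hu' hv',
    ← bondForce_sub hsubint hlin]
  exact (norm_bondForce_le (by omega) (by positivity) hrem).trans_eq (by ring)

end Linearization

section Stiffness

/-- The stiffness of an unstrained bond of bond vector `z`, up to the factor `g''(0)`. -/
noncomputable def bondTensor (z : Vec d) : Vec d →L[ℝ] Vec d :=
  (2 * M.bondMoment 2 z) • InnerProductSpace.rankOne ℝ (bondDir z 0) (bondDir z 0)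

theorem integrable_bondTensor : Integrable M.bondTensor := by
  have hd := M.two_le_dim
  have hdir : Measurable fun z : Vec d => bondDir z 0 := by
    unfold bondDir
    fun_prop
  have hrank : Continuous fun v : Vec d => InnerProductSpace.rankOne ℝ v v :=
    (InnerProductSpace.rankOne ℝ (E := Vec d) (F := Vec d)).continuous.clm_apply continuous_id
  have hdyad : AEStronglyMeasurable (fun z : Vec d =>
      InnerProductSpace.rankOne ℝ (bondDir z 0) (bondDir z 0)) volume :=
    (hrank.comp_stronglyMeasurable hdir.stronglyMeasurable).aestronglyMeasurable
  have hle : ∀ z : Vec d, ‖InnerProductSpace.rankOne ℝ (bondDir z 0) (bondDir z 0)‖ ≤ 1 :=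
    fun z => by
      rw [InnerProductSpace.norm_rankOne]
      exact mul_le_one₀ norm_bondDir_le (norm_nonneg _) norm_bondDir_le
  have hmoment : Integrable fun z => 2 * M.bondMoment 2 z :=
    (M.integrable_bondMoment (by omega)).const_mul 2
  exact hmoment.smul_bdd 1 hdyad (ae_of_all _ hle)

/-- The stiffness at the displacement `u` of the bond between `a.1` and `y`, where the displacement
of the end point `a.1` is replaced by the free parameter `a.2`; this makes the dependence on `a`
continuous although `u` is only measurable. -/
noncomputable def stiffness (u : Vec d → Vec d) (a : Vec d × Vec d) (y : Vec d) :
    Vec d →L[ℝ] Vec d :=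
  iteratedDeriv 2 M.g ((√‖y - a.1‖)⁻¹ * ⟪u y - a.2, bondDir y a.1⟫) • M.bondTensor (y - a.1)

theorem stiffness_apply (u : Vec d → Vec d) (x y v : Vec d) : M.stiffness u (x, u x) y v =
    (2 * M.bondMoment 2 (y - x) * iteratedDeriv 2 M.g (scaledStrain u (x, y)) *
      ⟪bondDir y x, v⟫) • bondDir y x := by
  have hdir : bondDir (y - x) 0 = bondDir y x := by unfold bondDir; rw [sub_zero]
  rw [stiffness, bondTensor, hdir, smul_apply, smul_apply, InnerProductSpace.rankOne_apply,
    scaledStrain_eq, smul_smul, smul_smul]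
  congr 1
  ring

theorem stiffness_apply_sub (u w : Vec d → Vec d) (x y : Vec d) :
    M.stiffness u (x, u x) y (w y - w x) =
      (2 * (M.bondMoment 1 (y - x) * M.tensionDeriv u w (x, y))) • bondDir y x := by
  rw [stiffness_apply, tensionDeriv, scaledStrain_eq (u := w), real_inner_comm]
  unfold bondMoment
  congr 1
  ring

variable {u : Vec d → Vec d}

theorem integrable_stiffness (hu : Measurable u) (a : Vec d × Vec d) :
    Integrable (M.stiffness u a) M.μ := by
  refine (M.integrable_bondTensor.comp_sub_right a.1).restrict.bdd_smul (iteratedDeriv 2 M.g 0)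
    (M.continuous_deriv2_g.measurable.comp ?_).aestronglyMeasurable
    (ae_of_all _ fun y => M.g_deriv2_max _)
  unfold bondDir
  fun_prop

theorem tendsto_integral_norm_stiffness_sub (hu : Measurable u) (a : Vec d × Vec d) :
    Tendsto (fun a' => ∫ y, ‖M.stiffness u a' y - M.stiffness u a y‖ ∂M.μ) (𝓝 a) (𝓝 0) := by
  have hT : ∀ a : Vec d × Vec d, Integrable fun y => M.bondTensor (y - a.1) := fun a =>
    M.integrable_bondTensor.comp_sub_right a.1
  let h (a : Vec d × Vec d) (y : Vec d) : ℝ :=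
    iteratedDeriv 2 M.g ((√‖y - a.1‖)⁻¹ * ⟪u y - a.2, bondDir y a.1⟫)
  have hmeas : ∀ a, Measurable (h a) := fun a => by
    refine M.continuous_deriv2_g.measurable.comp ?_
    unfold bondDir
    fun_prop
  have hTlim : Tendsto (fun a' : Vec d × Vec d =>
      ∫ y, ‖M.bondTensor (y - a'.1) - M.bondTensor (y - a.1)‖ ∂M.μ) (𝓝 a) (𝓝 0) := by
    refine squeeze_zero (fun _ => integral_nonneg fun _ => norm_nonneg _) (fun a' => ?_)
      ((tendsto_integral_norm_sub_translate M.integrable_bondTensor a.1).comp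
        (continuous_fst.tendsto a))
    exact setIntegral_le_integral ((hT a').sub (hT a)).norm (ae_of_all _ fun _ => norm_nonneg _)
  have hlim : ∀ y, Tendsto (fun a' => h a' y • M.bondTensor (y - a.1)) (𝓝 a)
      (𝓝 (h a y • M.bondTensor (y - a.1))) := fun y => by
    rcases eq_or_ne (y - a.1) 0 with hy | hy
    · have hzero : ∀ c : ℝ, c • M.bondTensor (y - a.1) = 0 := fun c => by
        ext v
        simp [hy, bondTensor, bondDir]
      simp only [hzero]
      exact tendsto_const_nhds (x := (0 : Vec d →L[ℝ] Vec d))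
    · have hn : ‖y - a.1‖ ≠ 0 := norm_ne_zero_iff.2 hy
      have hs : √‖y - a.1‖ ≠ 0 := (Real.sqrt_pos.2 (norm_pos_iff.2 hy)).ne'
      refine Tendsto.smul_const (M.continuous_deriv2_g.continuousAt.comp ?_ : ContinuousAt _ a) _
      unfold bondDir
      fun_prop (disch := assumption)
  exact tendsto_integral_norm_smul_sub (μ := M.μ) (h := h)
    (T := fun (a : Vec d × Vec d) y => M.bondTensor (y - a.1))
    (fun a => (hmeas a).aestronglyMeasurable) (fun a y => M.g_deriv2_max _)
    (fun a => (hT a).restrict) hTlim (ae_of_all _ hlim)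

/-- The stiffness kernels at the displacement `u` as a continuous family in `L¹`. -/
noncomputable def stiffnessFamily (hu : Measurable u) :
    C(Vec d × Vec d, Lp (Vec d →L[ℝ] Vec d) 1 M.μ) where
  toFun a := (M.integrable_stiffness hu a).toL1 (M.stiffness u a)
  continuous_toFun := by
    refine continuous_iff_continuousAt.2 fun a => tendsto_iff_norm_sub_tendsto_zero.2 ?_
    refine (M.tendsto_integral_norm_stiffness_sub hu a).congr fun a' => ?_
    rw [← Integrable.toL1_sub, L1.norm_of_fun_eq_integral_norm]
    rfl

theorem exists_measurable_graph_range_subset (u : M.Linf) :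
    ∃ φ : Vec d → ↥(closure M.Ω ×ˢ Metric.closedBall (0 : Vec d) ‖u‖), Measurable φ ∧
      ∀ᵐ x ∂M.μ, (φ x : Vec d × Vec d) = (x, u x) := by
  have hmem : ∀ᵐ x ∂M.μ, (x, u x) ∈ closure M.Ω ×ˢ Metric.closedBall (0 : Vec d) ‖u‖ := by
    filter_upwards [ae_restrict_mem M.isOpen_Ω.measurableSet, ae_norm_le_linfty_norm u] with x hx hu
    exact ⟨subset_closure hx, mem_closedBall_zero_iff.2 hu⟩
  obtain ⟨φ, hφ, hrange, hae⟩ := (measurable_id.prodMk (measurable_coe u)).aemeasurable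
    |>.exists_ae_eq_range_subset hmem ((M.isConnected_Ω.nonempty.closure).prod
      (Metric.nonempty_closedBall.2 (norm_nonneg u)))
  exact ⟨codRestrict φ _ fun x => hrange (mem_range_self x), hφ.subtype_mk,
    hae.mono fun x hx => hx.symm⟩

theorem integrable_stiffness_apply (hu : Measurable u) (a : Vec d × Vec d) (w : M.Linf) :
    Integrable (fun y => M.stiffness u a y (w y)) M.μ :=
  (ContinuousLinearMap.id ℝ (Vec d →L[ℝ] Vec d)).integrable_of_bilin_of_bdd_right ‖w‖
    (M.integrable_stiffness hu a) (Lp.aestronglyMeasurable w) (ae_norm_le_linfty_norm w)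

theorem bondForce_tensionDeriv_eq (u w : M.Linf) (x : Vec d) :
    M.bondForce (M.tensionDeriv u w) x =
      (∫ y, M.stiffness u (x, u x) y ∂M.μ) (w x) - ∫ y, M.stiffness u (x, u x) y (w y) ∂M.μ := by
  have hint := M.integrable_stiffness (measurable_coe u) (x, u x)
  rw [ContinuousLinearMap.integral_apply hint, ← integral_sub
    (hint.apply_continuousLinearMap _) (M.integrable_stiffness_apply (measurable_coe u) _ w),
    bondForce, ← integral_neg]
  refine integral_congr_ae (ae_of_all _ fun y => ?_)
  beta_reduce
  rw [← stiffness_apply_sub, ← map_neg, neg_sub, map_sub]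

theorem exists_linftyMul_sub_isCompactOperator (u : M.Linf) :
    ∃ (a : Lp (Vec d →L[ℝ] Vec d) ∞ M.μ) (K : M.Linf →L[ℝ] M.Linf), IsCompactOperator K ∧
      (a =ᵐ[M.μ] fun x => ∫ y, M.stiffness u (x, u x) y ∂M.μ) ∧
      ∀ w : M.Linf, (linftyMul a - K) w =ᵐ[M.μ] M.bondForce (M.tensionDeriv u w) := by
  have hu := measurable_coe u
  obtain ⟨φ, hφ, hgraph⟩ := M.exists_measurable_graph_range_subset u
  have : CompactSpace ↥(closure M.Ω ×ˢ Metric.closedBall (0 : Vec d) ‖u‖) :=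
    isCompact_iff_compactSpace.1
      (M.isBounded_Ω.isCompact_closure.prod (isCompact_closedBall _ _))
  let Λ := (M.stiffnessFamily hu).restrict (closure M.Ω ×ˢ Metric.closedBall (0 : Vec d) ‖u‖)
  have hΛ : ∀ᵐ x ∂M.μ, Λ (φ x) =ᵐ[M.μ] M.stiffness u (x, u x) := hgraph.mono fun x hx =>
    hx ▸ (M.integrable_stiffness hu (φ x)).coeFn_toL1
  obtain ⟨K, hK, hKw⟩ := exists_isCompactOperator_integral Λ hφ
  let a := linftyComp (μ := M.μ) (Vec d →L[ℝ] Vec d) hφ ⟨_, continuous_integral.comp Λ.continuous⟩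
  have ha : a =ᵐ[M.μ] fun x => ∫ y, M.stiffness u (x, u x) y ∂M.μ := by
    filter_upwards [coeFn_linftyComp hφ ⟨_, continuous_integral.comp Λ.continuous⟩, hΛ]
      with x hx hx'
    exact hx.trans (integral_congr_ae hx')
  refine ⟨a, K, hK, ha, fun w => ?_⟩
  filter_upwards [Lp.coeFn_sub (linftyMul a w) (K w), coeFn_linftyMul a w, hKw w, ha, hΛ]
    with x hsub hmul hKx hax hΛx
  rw [sub_apply, hsub, Pi.sub_apply, hmul, hax, hKx, bondForce_tensionDeriv_eq]
  congr 1
  exact integral_congr_ae (hΛx.mono fun y hy => by simp only [hy])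

end Stiffness

end CohesiveBody

section BallEllipticity

section Tent

variable {E : Type*} [NormedAddCommGroup E]

/-- The tent function over the ball of radius `ρ` about `a`: a minorant of the indicator function of
this ball which depends continuously on `a`. -/
noncomputable def tent (ρ : ℝ) (a z : E) : ℝ := max 0 (1 - ‖z - a‖ / ρ)

theorem tent_nonneg (ρ : ℝ) (a z : E) : 0 ≤ tent ρ a z := le_max_left _ _

theorem tent_le_one {ρ : ℝ} (hρ : 0 < ρ) (a z : E) : tent ρ a z ≤ 1 :=
  max_le zero_le_one (sub_le_self _ (by positivity))

theorem tent_pos {ρ : ℝ} {a z : E} (hz : z ∈ Metric.ball a ρ) : 0 < tent ρ a z := by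
  rw [mem_ball_iff_norm] at hz
  exact lt_max_of_lt_right (sub_pos.2 ((div_lt_one ((norm_nonneg _).trans_lt hz)).2 hz))

theorem tent_eq_zero {ρ : ℝ} (hρ : 0 < ρ) {a z : E} (hz : z ∉ Metric.ball a ρ) :
    tent ρ a z = 0 := by
  rw [mem_ball_iff_norm, not_lt] at hz
  exact max_eq_left (sub_nonpos.2 ((one_le_div hρ).2 hz))

end Tent

variable {E : Type*} [NormedAddCommGroup E] [InnerProductSpace ℝ E] {m : E → ℝ} {ρ : ℝ}

theorem norm_tent_mul_le (hm0 : ∀ z, 0 ≤ m z) (hρ : 0 < ρ) (a v z : E) :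
    ‖tent ρ a z * (m z * ⟪v, z⟫ ^ 2)‖ ≤ m z * ‖z‖ ^ 2 * ‖v‖ ^ 2 := by
  rw [norm_mul, norm_mul, norm_pow, Real.norm_of_nonneg (tent_nonneg ρ a z),
    Real.norm_of_nonneg (hm0 z)]
  calc
    _ ≤ 1 * (m z * (‖v‖ * ‖z‖) ^ 2) := by
      have := hm0 z
      gcongr
      · exact tent_le_one hρ a z
      · exact norm_inner_le_norm v z
    _ = _ := by ring

variable [FiniteDimensional ℝ E] [MeasurableSpace E] [BorelSpace E] {μ : Measure E}

theorem measurable_tent_mul (hm : Measurable m) (a v : E) :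
    Measurable fun z => tent ρ a z * (m z * ⟪v, z⟫ ^ 2) := by
  unfold tent
  fun_prop

theorem integrable_tent_mul (hm : Measurable m) (hm0 : ∀ z, 0 ≤ m z)
    (hint : Integrable (fun z => m z * ‖z‖ ^ 2) μ) (hρ : 0 < ρ) (a v : E) :
    Integrable (fun z => tent ρ a z * (m z * ⟪v, z⟫ ^ 2)) μ :=
  (hint.mul_const (‖v‖ ^ 2)).mono' (measurable_tent_mul hm a v).aestronglyMeasurable
    (ae_of_all _ (norm_tent_mul_le hm0 hρ a v))

theorem continuousOn_integral_tent_mul (hm : Measurable m) (hm0 : ∀ z, 0 ≤ m z)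
    (hint : Integrable (fun z => m z * ‖z‖ ^ 2) μ) (hρ : 0 < ρ) :
    ContinuousOn (fun p : E × E => ∫ z, tent ρ p.1 z * (m z * ⟪p.2, z⟫ ^ 2) ∂μ)
      {p | ‖p.2‖ = 1} := by
  refine continuousOn_of_dominated
    (fun p _ => (measurable_tent_mul hm p.1 p.2).aestronglyMeasurable)
    (fun p hp => ae_of_all _ fun z => ?_) hint (ae_of_all _ fun z => ?_)
  · have hp' : ‖p.2‖ = 1 := hp
    simpa only [hp', one_pow, mul_one] using norm_tent_mul_le hm0 hρ p.1 p.2 z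
  · unfold tent
    fun_prop

variable [μ.IsAddHaarMeasure]

theorem eq_zero_of_ae_inner_eq_zero {U : Set E} (hU : IsOpen U) (hne : U.Nonempty) {v : E}
    (h : ∀ᵐ z ∂μ.restrict U, ⟪v, z⟫ = 0) : v = 0 := by
  by_contra hv
  have hnull : μ (ℝ ∙ v)ᗮ = 0 := Measure.addHaar_submodule μ _ fun htop => hv <| by
    rwa [Submodule.orthogonal_eq_top_iff, Submodule.span_singleton_eq_bot] at htop
  have hmem : ∀ᵐ z ∂μ.restrict U, z ∈ ((ℝ ∙ v)ᗮ : Submodule ℝ E) := by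
    simpa only [Submodule.mem_orthogonal_singleton_iff_inner_right] using h
  refine (hU.measure_pos μ hne).ne' (measure_mono_null_ae ?_ hnull)
  exact (ae_restrict_iff' hU.measurableSet).1 hmem

theorem integral_tent_mul_pos (hm : Measurable m) (hm0 : ∀ z, 0 ≤ m z)
    (hint : Integrable (fun z => m z * ‖z‖ ^ 2) μ) (hρ : 0 < ρ) {a v : E}
    (hpos : ∀ z ∈ Metric.ball a ρ, 0 < m z) (hv : v ≠ 0) :
    0 < ∫ z, tent ρ a z * (m z * ⟪v, z⟫ ^ 2) ∂μ := by
  have hnonneg : ∀ z, 0 ≤ tent ρ a z * (m z * ⟪v, z⟫ ^ 2) := fun z =>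
    mul_nonneg (tent_nonneg ρ a z) (mul_nonneg (hm0 z) (sq_nonneg _))
  refine (integral_nonneg hnonneg).lt_of_ne' fun hzero => hv ?_
  have hae := (integral_eq_zero_iff_of_nonneg hnonneg (integrable_tent_mul hm hm0 hint hρ a v)).1
    hzero
  refine eq_zero_of_ae_inner_eq_zero (μ := μ) (U := Metric.ball a ρ) Metric.isOpen_ball
    (Metric.nonempty_ball.2 hρ) ?_
  filter_upwards [ae_restrict_of_ae hae, ae_restrict_mem measurableSet_ball] with z hz hzU
  simpa [(tent_pos hzU).ne', (hpos z hzU).ne'] using hz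

theorem exists_mul_norm_sq_le_setIntegral_ball (hm : Measurable m) (hm0 : ∀ z, 0 ≤ m z)
    (hint : Integrable (fun z => m z * ‖z‖ ^ 2) μ) (hρ : 0 < ρ) {c : ℝ}
    (hpos : ∀ a, ‖a‖ = c → ∀ z ∈ Metric.ball a ρ, 0 < m z) :
    ∃ γ > 0, ∀ a v : E, ‖a‖ = c → γ * ‖v‖ ^ 2 ≤ ∫ z in Metric.ball a ρ, m z * ⟪v, z⟫ ^ 2 ∂μ := by
  obtain ⟨γ, hγ, hmin⟩ := ((isCompact_sphere (0 : E) c).prod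
    (isCompact_sphere (0 : E) 1)).exists_forall_le' (a := 0)
    ((continuousOn_integral_tent_mul hm hm0 hint hρ).mono fun p hp => by simpa using hp.2)
    fun p hp => integral_tent_mul_pos hm hm0 hint hρ (hpos p.1 (by simpa using hp.1))
      (Metric.ne_of_mem_sphere hp.2 one_ne_zero)
  have hball : ∀ a v, ∫ z, tent ρ a z * (m z * ⟪v, z⟫ ^ 2) ∂μ ≤
      ∫ z in Metric.ball a ρ, m z * ⟪v, z⟫ ^ 2 ∂μ := fun a v => by
    rw [← setIntegral_eq_integral_of_forall_compl_eq_zero (s := Metric.ball a ρ) fun z hz => by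
      rw [tent_eq_zero hρ hz, zero_mul]]
    refine integral_mono (integrable_tent_mul hm hm0 hint hρ a v).restrict
      ((hint.mul_const (‖v‖ ^ 2)).mono' (by fun_prop) (ae_of_all _ fun z => ?_)).restrict
      fun z => mul_le_of_le_one_left (mul_nonneg (hm0 z) (sq_nonneg _)) (tent_le_one hρ a z)
    rw [norm_mul, norm_pow, Real.norm_of_nonneg (hm0 z), mul_assoc, ← mul_pow, mul_comm ‖z‖]
    have := hm0 z
    gcongr
    exact norm_inner_le_norm v z
  refine ⟨γ, hγ, fun a v ha => ?_⟩
  rcases eq_or_ne v 0 with rfl | hv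
  · simp
  · have hunit := (hmin (a, ‖v‖⁻¹ • v) ⟨by simpa using ha, by
      simpa using norm_smul_inv_norm (𝕜 := ℝ) hv⟩).trans (hball _ _)
    have hscale : ∀ z, m z * ⟪‖v‖⁻¹ • v, z⟫ ^ 2 = (‖v‖ ^ 2)⁻¹ * (m z * ⟪v, z⟫ ^ 2) := fun z => by
      rw [real_inner_smul_left]
      ring
    simp only [hscale] at hunit
    rwa [integral_const_mul, ← div_eq_inv_mul, le_div_iff₀ (by positivity)] at hunit

end BallEllipticity

section Ellipticity

theorem mem_finiteCone_of_mem_ball {d : ℕ} {x y e : Vec d} {θ c : ℝ} (hθ : 0 ≤ Real.cos θ)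
    (hc : 0 ≤ c) (he : ‖e‖ = 1) (hy : y - x ∈ Metric.ball (c • e) (c * (1 - Real.cos θ) / 2)) :
    y ∈ finiteCone x e (2 * c) θ := by
  have hdist : ‖(y - x) - c • e‖ < c * (1 - Real.cos θ) / 2 := mem_ball_iff_norm.1 hy
  have := Real.cos_le_one θ
  have hnorm : ‖y - x‖ ≤ c + c * (1 - Real.cos θ) / 2 := by
    have hce : ‖c • e‖ = c := by rw [norm_smul, he, mul_one, Real.norm_of_nonneg hc]
    have := norm_le_norm_add_norm_sub' (y - x) (c • e)
    linarith
  have hinner : c - c * (1 - Real.cos θ) / 2 ≤ ⟪y - x, e⟫ := by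
    have hce : ⟪c • e, e⟫ = c := by
      rw [real_inner_smul_left, real_inner_self_eq_norm_sq, he, one_pow, mul_one]
    have := neg_le_of_abs_le (abs_real_inner_le_norm ((y - x) - c • e) e)
    rw [inner_sub_left, hce, he, mul_one] at this
    linarith
  refine ⟨by nlinarith, (mul_le_mul_of_nonneg_right hnorm hθ).trans (le_trans ?_ hinner)⟩
  nlinarith [mul_nonneg hc (sq_nonneg (1 - Real.cos θ))]

namespace CohesiveBody

variable {d : ℕ} (M : CohesiveBody d)

theorem exists_mul_norm_sq_le_setIntegral_bond {c ρ : ℝ} (hρ : 0 < ρ) (hρc : ρ ≤ c)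
    (hc : c + ρ ≤ M.ε) : ∃ γ > 0, ∀ a v : Vec d, ‖a‖ = c → γ * ‖v‖ ^ 2 ≤
      ∫ z in Metric.ball a ρ, M.bondMoment 2 z * ⟪v, ‖z‖⁻¹ • z⟫ ^ 2 := by
  have hd := M.two_le_dim
  have hmeas := M.measurable_bondMoment 2
  have hmass : ∀ z, M.bondMoment 2 z * ‖z‖⁻¹ ^ 2 * ‖z‖ ^ 2 = M.bondMoment 2 z := fun z => by
    rcases eq_or_ne z 0 with rfl | hz
    · simp [bondMoment]
    · have := norm_ne_zero_iff.2 hz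
      field_simp
  obtain ⟨γ, hγ, hell⟩ := exists_mul_norm_sq_le_setIntegral_ball (μ := volume)
    (m := fun z => M.bondMoment 2 z * ‖z‖⁻¹ ^ 2) (by fun_prop)
    (fun z => mul_nonneg (M.bondMoment_nonneg 2 z) (by positivity))
    (by simpa only [hmass] using M.integrable_bondMoment (k := 2) (by omega)) hρ (c := c)
    fun a ha z hz => by
      rw [mem_ball_iff_norm] at hz
      have hlt : ‖z‖ < M.ε := by linarith [norm_le_norm_add_norm_sub' z a]
      have hz0 : 0 < ‖z‖ := by linarith [norm_le_norm_add_norm_sub' a z, norm_sub_rev z a]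
      have := M.bondDensity_pos (norm_pos_iff.1 hz0) hlt
      unfold bondMoment
      positivity
  refine ⟨γ, hγ, fun a v ha => (hell a v ha).trans_eq (integral_congr_ae (ae_of_all _ fun z => ?_))⟩
  simp only [real_inner_smul_right]
  ring

theorem integrable_bondMoment_two_mul_inner_sq (x v : Vec d) :
    Integrable fun y => M.bondMoment 2 (y - x) * ⟪v, bondDir y x⟫ ^ 2 := by
  have hd := M.two_le_dim
  have := M.measurable_bondMoment 2
  refine ((M.integrable_bondMoment (k := 2) (by omega)).comp_sub_right x).mul_bdd (c := ‖v‖ ^ 2) ?_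
    (ae_of_all _ fun y => ?_)
  · unfold bondDir
    exact (by fun_prop : Measurable _).aestronglyMeasurable
  · rw [norm_pow]
    gcongr
    exact (norm_inner_le_norm v _).trans (mul_le_of_le_one_right (norm_nonneg v) norm_bondDir_le)

theorem exists_mul_norm_sq_le_integral_bond (hcone : InteriorConeCondition M.Ω) :
    ∃ γ > 0, ∀ x ∈ M.Ω, ∀ v, γ * ‖v‖ ^ 2 ≤
      ∫ y, M.bondMoment 2 (y - x) * ⟪v, bondDir y x⟫ ^ 2 ∂M.μ := by
  obtain ⟨θ, l, hθ0, hθ, hl, hcone⟩ := hcone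
  have hcos0 : 0 < Real.cos θ := Real.cos_pos_of_mem_Ioo ⟨by linarith, hθ⟩
  have hcos1 : Real.cos θ < 1 := by
    rw [← Real.cos_zero]
    exact Real.cos_lt_cos_of_nonneg_of_le_pi_div_two le_rfl hθ.le hθ0
  have hε := M.ε_pos
  set c := min l M.ε / 2
  have hc : 0 < c := by positivity
  have hcl : 2 * c ≤ l := (mul_div_cancel₀ _ two_ne_zero).trans_le (min_le_left _ _)
  have hcε : 2 * c ≤ M.ε := (mul_div_cancel₀ _ two_ne_zero).trans_le (min_le_right _ _)
  have hρc : c * (1 - Real.cos θ) / 2 ≤ c := by nlinarith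
  obtain ⟨γ, hγ, hell⟩ := M.exists_mul_norm_sq_le_setIntegral_bond
    (show 0 < c * (1 - Real.cos θ) / 2 from half_pos (mul_pos hc (sub_pos.2 hcos1))) hρc
    (by linarith)
  refine ⟨γ, hγ, fun x hx v => ?_⟩
  obtain ⟨e, he, hsub⟩ := hcone x hx
  have hball : (fun y => y - x) ⁻¹' Metric.ball (c • e) (c * (1 - Real.cos θ) / 2) ⊆ M.Ω :=
    fun y hy => hsub <| by
      have hmem := mem_finiteCone_of_mem_ball hcos0.le hc.le he hy
      exact ⟨hmem.1.trans hcl, hmem.2⟩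
  calc
    γ * ‖v‖ ^ 2 ≤ _ := hell (c • e) v (by rw [norm_smul, he, mul_one, Real.norm_of_nonneg hc.le])
    _ = ∫ y in (fun y => y - x) ⁻¹' Metric.ball (c • e) (c * (1 - Real.cos θ) / 2),
        M.bondMoment 2 (y - x) * ⟪v, bondDir y x⟫ ^ 2 :=
      ((measurePreserving_sub_right volume x).setIntegral_preimage_emb
        (measurableEmbedding_subRight x) _ _).symm
    _ ≤ _ := setIntegral_mono_set (M.integrable_bondMoment_two_mul_inner_sq x v).integrableOn
      (ae_of_all _ fun y => mul_nonneg (M.bondMoment_nonneg 2 _) (sq_nonneg _))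
      hball.eventuallyLE

theorem StrictlyInsideStrengthDomain.exists_deriv2_ge {M : CohesiveBody d} {u : M.Linf}
    (h : M.StrictlyInsideStrengthDomain u) : ∃ m > 0, ∀ᵐ p ∂(M.μ.prod M.μ),
      dist p.2 p.1 < M.ε → m ≤ iteratedDeriv 2 M.g (scaledStrain u p) := by
  obtain ⟨r₁, r₂, h₁, h₂, h⟩ := h
  obtain ⟨m, hm, hmin⟩ := isCompact_Icc.exists_forall_le' (f := iteratedDeriv 2 M.g) (a := 0)
    M.continuous_deriv2_g.continuousOn (s := Icc r₁ r₂)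
    fun r hr => M.g_deriv2_pos r (h₁.trans_le hr.1) (hr.2.trans_lt h₂)
  exact ⟨m, hm, h.mono fun p hp hlt => hmin _ (hp hlt)⟩

theorem inner_stiffness_apply (u : Vec d → Vec d) (x y v : Vec d) :
    ⟪v, M.stiffness u (x, u x) y v⟫ = 2 * (iteratedDeriv 2 M.g (scaledStrain u (x, y)) *
      (M.bondMoment 2 (y - x) * ⟪v, bondDir y x⟫ ^ 2)) := by
  rw [stiffness_apply, real_inner_smul_right, real_inner_comm]
  ring

theorem StrictlyInsideStrengthDomain.exists_stiffness_elliptic {M : CohesiveBody d}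
    (hcone : InteriorConeCondition M.Ω) {u : M.Linf} (h : M.StrictlyInsideStrengthDomain u) :
    ∃ γ > 0, ∀ᵐ x ∂M.μ, ∀ v,
      γ * ‖v‖ ^ 2 ≤ ⟪(∫ y, M.stiffness u (x, u x) y ∂M.μ) v, v⟫ := by
  obtain ⟨m, hm, hge⟩ := h.exists_deriv2_ge
  obtain ⟨γ, hγ, hell⟩ := M.exists_mul_norm_sq_le_integral_bond hcone
  refine ⟨2 * (m * γ), by positivity, ?_⟩
  filter_upwards [ae_restrict_mem M.isOpen_Ω.measurableSet, Measure.ae_ae_of_ae_prod hge]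
    with x hx hgex v
  have hint := M.integrable_stiffness (measurable_coe u) (x, u x)
  have hintv := hint.apply_continuousLinearMap v
  have hbond : ∀ᵐ y ∂M.μ, 2 * (m * (M.bondMoment 2 (y - x) * ⟪v, bondDir y x⟫ ^ 2)) ≤
      ⟪v, M.stiffness u (x, u x) y v⟫ := by
    filter_upwards [hgex] with y hy
    have := M.bondMoment_nonneg 2 (y - x)
    rw [inner_stiffness_apply]
    rcases lt_or_ge ‖y - x‖ M.ε with hlt | hle
    · have := hy (by rwa [dist_eq_norm])
      gcongr
    · simp [bondMoment, M.bondDensity_of_le hle]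
  calc
    2 * (m * γ) * ‖v‖ ^ 2 = 2 * (m * (γ * ‖v‖ ^ 2)) := by ring
    _ ≤ 2 * (m * ∫ y, M.bondMoment 2 (y - x) * ⟪v, bondDir y x⟫ ^ 2 ∂M.μ) := by
      gcongr
      exact hell x hx v
    _ = ∫ y, 2 * (m * (M.bondMoment 2 (y - x) * ⟪v, bondDir y x⟫ ^ 2)) ∂M.μ := by
      rw [integral_const_mul, integral_const_mul]
    _ ≤ ∫ y, ⟪v, M.stiffness u (x, u x) y v⟫ ∂M.μ :=
      integral_mono_of_nonneg (ae_of_all _ fun y => by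
        have := M.bondMoment_nonneg 2 (y - x)
        dsimp only [Pi.zero_apply]
        positivity) (hintv.const_inner v) hbond
    _ = _ := by rw [integral_inner hintv, ContinuousLinearMap.integral_apply hint, real_inner_comm]

end CohesiveBody

end Ellipticity

section RigidMotions

theorem inner_toEuclideanLin_self_eq_zero_iff {n : Type*} [Fintype n] [DecidableEq n]
    {Q : Matrix n n ℝ} :
    (∀ v, ⟪Matrix.toEuclideanLin Q v, v⟫ = 0) ↔ Q.transpose = -Q := by
  have hsymm : (Matrix.toEuclideanLin (Q + Q.transpose)).IsSymmetric :=
    Matrix.isSymmetric_toEuclideanLin_iff.2 (Matrix.isHermitian_add_transpose_self Q)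
  have hdouble : ∀ v, ⟪Matrix.toEuclideanLin (Q + Q.transpose) v, v⟫ =
      2 * ⟪Matrix.toEuclideanLin Q v, v⟫ := fun v => by
    rw [map_add, LinearMap.add_apply, inner_add_left,
      ← Matrix.conjTranspose_eq_transpose_of_trivial,
      Matrix.toEuclideanLin_conjTranspose_eq_adjoint, LinearMap.adjoint_inner_left,
      real_inner_comm, two_mul]
  rw [eq_neg_iff_add_eq_zero, add_comm, ← (Matrix.toEuclideanLin).map_eq_zero_iff,
    ← hsymm.inner_map_self_eq_zero]
  simp only [hdouble, mul_eq_zero, OfNat.ofNat_ne_zero, false_or]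

theorem mem_rigidMotions_iff {d : ℕ} {w : Vec d → Vec d} : w ∈ rigidMotions d ↔
    ∃ (T : Vec d →ₗ[ℝ] Vec d) (c : Vec d), (∀ v, ⟪T v, v⟫ = 0) ∧ w = fun x => T x + c := by
  simp only [Matrix.toEuclideanLin.surjective.exists, inner_toEuclideanLin_self_eq_zero_iff]
  rfl

namespace CohesiveBody

variable {d : ℕ} (M : CohesiveBody d)

theorem memLp_affine (T : Vec d →ₗ[ℝ] Vec d) (c : Vec d) : MemLp (fun x => T x + c) ∞ M.μ := by
  have hcont : Continuous fun x => T x + c :=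
    T.continuous_of_finiteDimensional.add continuous_const
  obtain ⟨C, hC⟩ := (M.isBounded_Ω.isCompact_closure.image hcont).isBounded.exists_norm_le
  refine memLp_top_of_bound hcont.aestronglyMeasurable C ?_
  filter_upwards [ae_restrict_mem M.isOpen_Ω.measurableSet] with x hx
  exact hC _ ⟨x, subset_closure hx, rfl⟩

/-- The affine maps `x ↦ T x + c`, as elements of `L^∞(Ω; ℝ^d)`. -/
noncomputable def linftyAffine : (Vec d →ₗ[ℝ] Vec d) × Vec d →ₗ[ℝ] M.Linf where
  toFun w := (M.memLp_affine w.1 w.2).toLp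
  map_add' w w' := by
    rw [← MemLp.toLp_add]
    exact MemLp.toLp_congr _ _ (ae_of_all _ fun x => add_add_add_comm _ _ _ _)
  map_smul' c w := by
    rw [RingHom.id_apply, ← MemLp.toLp_const_smul]
    exact MemLp.toLp_congr _ _ (ae_of_all _ fun x => (smul_add c (w.1 x) w.2).symm)

theorem coeFn_linftyAffine (T : Vec d →ₗ[ℝ] Vec d) (c : Vec d) :
    M.linftyAffine (T, c) =ᵐ[M.μ] fun x => T x + c :=
  (M.memLp_affine T c).coeFn_toLp

/-- The rigid motions, as a subspace of `L^∞(Ω; ℝ^d)`. -/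
noncomputable def rigidSubmodule : Submodule ℝ M.Linf :=
  ((⨅ v : Vec d, LinearMap.ker ((innerₗ (Vec d) v).comp (LinearMap.applyₗ v))).prod ⊤).map
    M.linftyAffine

instance : FiniteDimensional ℝ M.rigidSubmodule := by
  unfold rigidSubmodule
  infer_instance

variable {M}

theorem mem_rigidSubmodule_iff {n : M.Linf} : n ∈ M.rigidSubmodule ↔
    ∃ (T : Vec d →ₗ[ℝ] Vec d) (c : Vec d),
      (∀ v, ⟪T v, v⟫ = 0) ∧ n =ᵐ[M.μ] fun x => T x + c := by
  have hker : ∀ T : Vec d →ₗ[ℝ] Vec d, T ∈ ⨅ v : Vec d, LinearMap.ker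
      ((innerₗ (Vec d) v).comp (LinearMap.applyₗ v)) ↔ ∀ v, ⟪T v, v⟫ = 0 := fun T => by
    simp only [Submodule.mem_iInf, real_inner_comm]
    rfl
  simp only [rigidSubmodule, Submodule.mem_map, Submodule.mem_prod, Prod.exists, hker,
    Submodule.mem_top, and_true]
  refine exists₂_congr fun T c => and_congr_right fun _ => ⟨fun h => ?_, fun h => ?_⟩
  · exact h ▸ M.coeFn_linftyAffine T c
  · exact Lp.ext ((M.coeFn_linftyAffine T c).trans h.symm)

theorem mem_V_iff {u : M.Linf} : u ∈ M.V ↔ ∀ n ∈ M.rigidSubmodule, linftyPairing n u = 0 := by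
  have hpair : ∀ {n : M.Linf} {w : Vec d → Vec d}, n =ᵐ[M.μ] w →
      linftyPairing n u = ∫ x, ⟪u x, w x⟫ ∂M.μ := fun h => by
    rw [linftyPairing_comm]
    exact integral_congr_ae (h.mono fun x hx => by beta_reduce; rw [hx])
  constructor
  · intro hu n hn
    obtain ⟨T, c, hT, hn⟩ := mem_rigidSubmodule_iff.1 hn
    rw [hpair hn]
    exact hu _ (mem_rigidMotions_iff.2 ⟨T, c, hT, rfl⟩)
  · intro hu w hw
    obtain ⟨T, c, hT, rfl⟩ := mem_rigidMotions_iff.1 hw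
    rw [← hpair (M.coeFn_linftyAffine T c)]
    exact hu _ (mem_rigidSubmodule_iff.2 ⟨T, c, hT, M.coeFn_linftyAffine T c⟩)

theorem isClosed_V : IsClosed (M.V : Set M.Linf) := by
  have : (M.V : Set M.Linf) = ⋂ n ∈ M.rigidSubmodule, {u | linftyPairing n u = 0} := by
    ext u
    simp only [mem_iInter]
    exact mem_V_iff
  rw [this]
  exact isClosed_biInter fun n _ =>
    isClosed_eq (linftyPairing n).continuous continuous_const

instance : CompleteSpace M.V := isClosed_V.completeSpace_coe

theorem ae_scaledStrain_eq_zero_of_mem_rigidSubmodule {n : M.Linf} (hn : n ∈ M.rigidSubmodule) :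
    ∀ᵐ p ∂(M.μ.prod M.μ), scaledStrain n p = 0 := by
  obtain ⟨T, c, hT, hn⟩ := mem_rigidSubmodule_iff.1 hn
  filter_upwards [Measure.quasiMeasurePreserving_fst.ae hn,
    Measure.quasiMeasurePreserving_snd.ae hn] with p h1 h2
  rw [scaledStrain_eq_zero_iff, h1, h2, add_sub_add_right_eq_sub, ← map_sub, hT]

theorem eq_zero_of_mem_V {w : M.Linf} (hw : w ∈ M.V)
    (h : ∀ᵐ p ∂M.bondMeasure, scaledStrain w p = 0) : w = 0 := by
  have hzero := (M.ae_bondMeasure_iff fun x => by simp [scaledStrain_eq_zero_iff]).1 h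
  obtain ⟨T, c, hT, hwT⟩ := exists_rigid_of_ae_inner_eq_zero M.isOpen_Ω M.isConnected_Ω M.ε_pos
    (μ := volume) (w := w) <| by
      filter_upwards [Measure.ae_ae_of_ae_prod hzero] with x hx
      filter_upwards [hx] with y hy hlt
      exact (scaledStrain_eq_zero_iff (x, y)).1 (hy hlt)
  exact eq_zero_of_linftyPairing_self
    (mem_V_iff.1 hw w (mem_rigidSubmodule_iff.2 ⟨T, c, hT, hwT⟩))

/-- Bond forces exert no net force or torque, as they do no work in a rigid motion. -/
theorem mem_V_of_ae_eq_bondForce {G : Vec d × Vec d → ℝ} (hsymm : ∀ p, G p.swap = G p)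
    (hG : Integrable (fun p => (√‖p.2 - p.1‖)⁻¹ * G p) M.bondMeasure) {f : M.Linf}
    (hf : f =ᵐ[M.μ] M.bondForce G) : f ∈ M.V :=
  mem_V_iff.2 fun n hn => by
    rw [linftyPairing_comm, linftyPairing_eq_integral_bondMeasure hsymm hG hf]
    refine integral_eq_zero_of_ae ?_
    filter_upwards [M.ae_bondMeasure_of_ae (ae_scaledStrain_eq_zero_of_mem_rigidSubmodule hn)]
      with p hp
    rw [hp, mul_zero, Pi.zero_apply]

end CohesiveBody

end RigidMotions

section Linearization

namespace CohesiveBody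

variable {d : ℕ} {M : CohesiveBody d}

theorem StrictlyInsideStrengthDomain.mem_strengthDomain {u : M.Linf}
    (h : M.StrictlyInsideStrengthDomain u) : u ∈ M.strengthDomain := by
  obtain ⟨r₁, r₂, h₁, h₂, h⟩ := h
  exact h.mono fun p hp hlt => Icc_subset_Ioo h₁ h₂ (hp hlt)

theorem integrable_bondMeasure_of_abs_le {k : ℕ} (hk : k < 2 * d) {f : Vec d × Vec d → ℝ} {C : ℝ}
    (hf : Measurable f) (h : ∀ᵐ p ∂(M.μ.prod M.μ), |f p| ≤ C * (√‖p.2 - p.1‖)⁻¹ ^ k) :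
    Integrable f M.bondMeasure :=
  ((M.integrable_inv_sqrt_pow_bondMeasure hk).const_mul C).mono' hf.aestronglyMeasurable
    (M.ae_bondMeasure_of_ae h)

theorem integrable_mul_deriv_g_scaledStrain (u : M.Linf) :
    Integrable (fun p => (√‖p.2 - p.1‖)⁻¹ * (deriv M.g ∘ scaledStrain u) p) M.bondMeasure := by
  have hd := M.two_le_dim
  obtain ⟨C, -, hC⟩ := M.exists_abs_deriv_g_le
  have hu := measurable_scaledStrain (measurable_coe u)
  refine integrable_bondMeasure_of_abs_le (k := 1) (C := C) (by omega)
    (.mul (by fun_prop) ((measurable_deriv M.g).comp hu)) (ae_of_all _ fun p => ?_)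
  rw [abs_mul, abs_of_nonneg (inv_nonneg.2 (Real.sqrt_nonneg _)), mul_comm, pow_one]
  gcongr
  exact hC _

theorem linftyPairing_L (u φ : M.Linf) : linftyPairing (M.L u) φ =
    ∫ p, deriv M.g (scaledStrain u p) * scaledStrain φ p ∂M.bondMeasure :=
  linftyPairing_eq_integral_bondMeasure
    (fun p => by rw [Function.comp_apply, scaledStrain_swap, Function.comp_apply])
    (integrable_mul_deriv_g_scaledStrain u) (coeFn_L u) φ

theorem L_mem_V (u : M.Linf) : M.L u ∈ M.V :=
  mem_V_of_ae_eq_bondForce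
    (fun p => by rw [Function.comp_apply, scaledStrain_swap, Function.comp_apply])
    (integrable_mul_deriv_g_scaledStrain u) (coeFn_L u)

theorem integrable_mul_tensionDeriv (u w : M.Linf) :
    Integrable (fun p => (√‖p.2 - p.1‖)⁻¹ * M.tensionDeriv u w p) M.bondMeasure := by
  have hd := M.two_le_dim
  have hmeas := M.measurable_tensionDeriv (measurable_coe u) (measurable_coe w)
  refine integrable_bondMeasure_of_abs_le (k := 2) (by omega) (.mul (by fun_prop) hmeas)
    (C := iteratedDeriv 2 M.g 0 * (2 * ‖w‖)) ?_
  filter_upwards [M.ae_abs_tensionDeriv_le u w] with p hp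
  have hq : 0 ≤ (√‖p.2 - p.1‖)⁻¹ := inv_nonneg.2 (Real.sqrt_nonneg _)
  rw [abs_mul, abs_of_nonneg hq]
  exact (mul_le_mul_of_nonneg_left hp hq).trans_eq (by ring)

theorem integrable_tensionDeriv_mul_scaledStrain (u w : M.Linf) :
    Integrable (fun p => M.tensionDeriv u w p * scaledStrain w p) M.bondMeasure := by
  have hd := M.two_le_dim
  refine integrable_bondMeasure_of_abs_le (k := 2) (by omega)
    ((M.measurable_tensionDeriv (measurable_coe u) (measurable_coe w)).mul
      (measurable_scaledStrain (measurable_coe w)))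
    (C := iteratedDeriv 2 M.g 0 * (2 * ‖w‖) ^ 2) ?_
  filter_upwards [M.ae_abs_tensionDeriv_le u w, ae_abs_scaledStrain_le w] with p htan hstrain
  rw [abs_mul]
  exact (mul_le_mul htan hstrain (abs_nonneg _) ((abs_nonneg _).trans htan)).trans_eq (by ring)

variable {u : M.Linf}

theorem ae_tensionDeriv_mul_scaledStrain_nonneg (hu : u ∈ M.strengthDomain) (w : Vec d → Vec d) :
    ∀ᵐ p ∂M.bondMeasure, 0 ≤ M.tensionDeriv u w p * scaledStrain w p := by
  filter_upwards [M.mem_strengthDomain_iff.1 hu] with p hp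
  rw [tensionDeriv, mul_assoc]
  exact mul_nonneg (M.g_deriv2_pos _ hp.1 hp.2).le (mul_self_nonneg _)

theorem eq_zero_of_integral_tensionDeriv_eq_zero (hu : u ∈ M.strengthDomain) {w : M.Linf}
    (hw : w ∈ M.V) (h : ∫ p, M.tensionDeriv u w p * scaledStrain w p ∂M.bondMeasure = 0) :
    w = 0 := by
  have hzero := (integral_eq_zero_iff_of_nonneg_ae (ae_tensionDeriv_mul_scaledStrain_nonneg hu w)
    (integrable_tensionDeriv_mul_scaledStrain u w)).1 h
  refine eq_zero_of_mem_V hw ?_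
  filter_upwards [hzero, M.mem_strengthDomain_iff.1 hu] with p hp hpu
  rw [tensionDeriv, mul_assoc, Pi.zero_apply] at hp
  exact mul_self_eq_zero.1 ((mul_eq_zero_iff_left (M.g_deriv2_pos _ hpu.1 hpu.2).ne').1 hp)

theorem StrictlyInsideStrengthDomain.exists_linearization (hcone : InteriorConeCondition M.Ω)
    (hu : M.StrictlyInsideStrengthDomain u) :
    ∃ (D : M.Linf →L[ℝ] M.Linf) (A : M.V ≃L[ℝ] M.V),
      (∀ w, D w =ᵐ[M.μ] M.bondForce (M.tensionDeriv u w)) ∧ ∀ w : M.V, (A w : M.Linf) = D w := by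
  obtain ⟨a, K, hK, ha, hD⟩ := M.exists_linftyMul_sub_isCompactOperator u
  obtain ⟨γ, hγ, hell⟩ := hu.exists_stiffness_elliptic hcone
  have hunit : IsUnit (linftyMul a) := isUnit_linftyMul_of_elliptic hγ <| by
    filter_upwards [ha, hell] with x hax hx
    rwa [hax]
  have hpair : ∀ w, linftyPairing w ((linftyMul a - K) w) =
      ∫ p, M.tensionDeriv u w p * scaledStrain w p ∂M.bondMeasure := fun w => by
    rw [linftyPairing_comm]
    exact linftyPairing_eq_integral_bondMeasure (M.tensionDeriv_swap u w)
      (integrable_mul_tensionDeriv u w) (hD w) w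
  obtain ⟨A, hA⟩ := exists_continuousLinearEquiv_of_isCompactOperator linftyPairing_comm
    (fun _ => eq_zero_of_linftyPairing_self) (fun _ => mem_V_iff) hunit hK
    (fun w => mem_V_of_ae_eq_bondForce (M.tensionDeriv_swap u w)
      (integrable_mul_tensionDeriv u w) (hD w))
    (fun w => (hpair w).symm ▸ integral_nonneg_of_ae
      (ae_tensionDeriv_mul_scaledStrain_nonneg hu.mem_strengthDomain w))
    (fun w hw h => eq_zero_of_integral_tensionDeriv_eq_zero hu.mem_strengthDomain hw
      ((hpair w).symm.trans h))
  exact ⟨linftyMul a - K, A, hD, hA⟩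

end CohesiveBody

end Linearization

section Energy

namespace CohesiveBody

variable {d : ℕ} (M : CohesiveBody d)

theorem continuous_g : Continuous M.g :=
  continuous_iff_continuousAt.2 fun r => (M.hasDerivAt_g r).continuousAt

theorem integrable_g_scaledStrain (u : M.Linf) :
    Integrable (fun p => M.g (scaledStrain u p)) M.bondMeasure := by
  obtain ⟨C, hC⟩ := M.g_bounded 0 (by norm_num)
  refine .of_bound (M.continuous_g.measurable.comp
    (measurable_scaledStrain (measurable_coe u))).aestronglyMeasurable C (ae_of_all _ fun p => ?_)
  simpa only [iteratedDeriv_zero, Real.norm_eq_abs] using hC (scaledStrain u p)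

theorem PD_eq_integral_bondMeasure (u : M.Linf) :
    M.PD u = ∫ p, M.g (scaledStrain u p) ∂M.bondMeasure := by
  rw [integral_bondMeasure,
    integral_prod _ (M.integrable_bondMeasure_iff.1 (M.integrable_g_scaledStrain u))]
  refine integral_congr_ae (ae_of_all _ fun x => M.setIntegral_ball_eq x (fun y hy => ?_)
    (fun y hy => mul_eq_zero_of_left (M.bondDensity_of_le hy) _))
  have := M.ε_pos
  have := M.ω_pos
  rw [M.bondDensity_of_lt hy]
  unfold potential scaledStrain
  rcases (norm_nonneg (y - x)).eq_or_lt with h | h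
  · simp [← h, M.g_zero]
  · field_simp

/-- The excess of the bond potential at the displacement `v` over its tangent line at `u`. -/
noncomputable def bondExcess (u v : Vec d → Vec d) (p : Vec d × Vec d) : ℝ :=
  M.g (scaledStrain v p) - M.g (scaledStrain u p) -
    deriv M.g (scaledStrain u p) * (scaledStrain v p - scaledStrain u p)

variable {M}

theorem ae_abs_bondExcess_le (u v : M.Linf) : ∀ᵐ p ∂(M.μ.prod M.μ),
    |M.bondExcess u v p| ≤ iteratedDeriv 2 M.g 0 * (2 * ‖v - u‖) ^ 2 * (√‖p.2 - p.1‖)⁻¹ ^ 2 := by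
  filter_upwards [ae_abs_scaledStrain_sub_le (le_refl ‖v - u‖)] with p hp
  have hnonneg := M.deriv2_g_zero_nonneg
  refine (abs_sub_sub_mul_le_of_lipschitz_deriv M.hasDerivAt_g M.abs_deriv_g_sub_le hp
    (by rw [sub_self, abs_zero]; exact (abs_nonneg _).trans hp)).trans ?_
  calc
    _ ≤ iteratedDeriv 2 M.g 0 * (2 * ‖v - u‖ * (√‖p.2 - p.1‖)⁻¹) *
        (2 * ‖v - u‖ * (√‖p.2 - p.1‖)⁻¹) := by gcongr
    _ = _ := by ring

theorem integrable_bondExcess (u v : M.Linf) : Integrable (M.bondExcess u v) M.bondMeasure := by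
  have hd := M.two_le_dim
  have hu := measurable_scaledStrain (measurable_coe u)
  have hv := measurable_scaledStrain (measurable_coe v)
  have hg := M.continuous_g.measurable
  have hg' := measurable_deriv M.g
  exact integrable_bondMeasure_of_abs_le (by omega)
    (((hg.comp hv).sub (hg.comp hu)).sub ((hg'.comp hu).mul (hv.sub hu)))
    (ae_abs_bondExcess_le u v)

theorem E_eq_add_integral_bondExcess (b u v : M.Linf) :
    M.E b v = M.E b u + linftyPairing (M.L u - b) (v - u) +
      ∫ p, M.bondExcess u v p ∂M.bondMeasure := by
  have hgu := M.integrable_g_scaledStrain u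
  have hgv := M.integrable_g_scaledStrain v
  have hsub : Integrable (fun p => M.g (scaledStrain v p) - M.g (scaledStrain u p))
      M.bondMeasure := hgv.sub hgu
  have hlin : (fun p => M.g (scaledStrain v p) - M.g (scaledStrain u p) - M.bondExcess u v p)
      =ᵐ[M.bondMeasure]
      fun p => deriv M.g (scaledStrain u p) * scaledStrain (v - u : M.Linf) p := by
    filter_upwards [M.ae_bondMeasure_of_ae (ae_scaledStrain_sub v u)] with p hp
    rw [hp, bondExcess, sub_sub_cancel]
  have hL := linftyPairing_L u (v - u)
  rw [← integral_congr_ae hlin, integral_sub hsub (integrable_bondExcess u v),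
    integral_sub hgv hgu, ← PD_eq_integral_bondMeasure, ← PD_eq_integral_bondMeasure] at hL
  have hE : ∀ w, M.E b w = M.PD w - linftyPairing b w := fun w => by
    rw [linftyPairing_comm]
    rfl
  rw [hE, hE, map_sub linftyPairing, sub_apply, map_sub (linftyPairing b), hL]
  ring

theorem hasFDerivAt_E (b u : M.Linf) : HasFDerivAt (M.E b) (linftyPairing (M.L u - b)) u := by
  have hd := M.two_le_dim
  have hint := M.integrable_inv_sqrt_pow_bondMeasure (k := 2) (by omega)
  refine hasFDerivAt_of_norm_sub_le_sq (C := iteratedDeriv 2 M.g 0 * 4 *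
    ∫ p, (√‖p.2 - p.1‖)⁻¹ ^ 2 ∂M.bondMeasure) fun v => ?_
  rw [E_eq_add_integral_bondExcess b u v, add_assoc, add_sub_cancel_left, add_sub_cancel_left]
  refine (norm_integral_le_of_norm_le (hint.const_mul _)
    (M.ae_bondMeasure_of_ae (ae_abs_bondExcess_le u v))).trans_eq ?_
  rw [integral_const_mul]
  ring

theorem IsCriticalPoint.L_eq {b u : M.Linf} (h : M.IsCriticalPoint b u) : M.L u = b := by
  have hderiv : linftyPairing (M.L u - b) = 0 := (hasFDerivAt_E b u).unique h
  exact sub_eq_zero.1 (eq_zero_of_linftyPairing_self (by rw [hderiv]; rfl))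

theorem IsCriticalPoint.E_eq_add {b u : M.Linf} (h : M.IsCriticalPoint b u) (v : M.Linf) :
    M.E b v = M.E b u + ∫ p, M.bondExcess u v p ∂M.bondMeasure := by
  rw [E_eq_add_integral_bondExcess b u v, h.L_eq, sub_self, map_zero, zero_apply, add_zero]

variable {b u v : M.Linf}

theorem strictConvexOn_g : StrictConvexOn ℝ (Icc M.re M.rc) M.g := by
  refine strictConvexOn_of_deriv2_pos (convex_Icc _ _) M.continuous_g.continuousOn fun r hr => ?_
  rw [interior_Icc] at hr
  rw [← iteratedDeriv_eq_iterate]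
  exact M.g_deriv2_pos r hr.1 hr.2

theorem bondExcess_pos {u v : Vec d → Vec d} {p : Vec d × Vec d}
    (hu : scaledStrain u p ∈ Ioo M.re M.rc) (hv : scaledStrain v p ∈ Ioo M.re M.rc)
    (hne : scaledStrain u p ≠ scaledStrain v p) : 0 < M.bondExcess u v p := by
  have := add_mul_sub_lt_of_strictConvexOn strictConvexOn_g (Ioo_subset_Icc_self hu)
    (Ioo_subset_Icc_self hv) hne (M.hasDerivAt_g _)
  rw [bondExcess]
  linarith

theorem ae_bondExcess_nonneg (hu : u ∈ M.strengthDomain) (hv : v ∈ M.strengthDomain) :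
    ∀ᵐ p ∂M.bondMeasure, 0 ≤ M.bondExcess u v p := by
  filter_upwards [M.mem_strengthDomain_iff.1 hu, M.mem_strengthDomain_iff.1 hv] with p hup hvp
  rcases eq_or_ne (scaledStrain u p) (scaledStrain v p) with h | h
  · simp [bondExcess, h]
  · exact (bondExcess_pos hup hvp h).le

theorem IsCriticalPoint.E_le (h : M.IsCriticalPoint b u) (hu : u ∈ M.strengthDomain)
    (hv : v ∈ M.strengthDomain) : M.E b u ≤ M.E b v := by
  rw [h.E_eq_add v]
  exact le_add_of_nonneg_right (integral_nonneg_of_ae (ae_bondExcess_nonneg hu hv))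

theorem IsCriticalPoint.eq_of_E_eq (h : M.IsCriticalPoint b u) (hu : u ∈ M.strengthDomain)
    (hv : v ∈ M.strengthDomain) (huV : u ∈ M.V) (hvV : v ∈ M.V) (hE : M.E b v = M.E b u) :
    v = u := by
  have hzero := (integral_eq_zero_iff_of_nonneg_ae (ae_bondExcess_nonneg hu hv)
    (integrable_bondExcess u v)).1 (by simpa only [hE, left_eq_add] using h.E_eq_add v)
  refine sub_eq_zero.1 (eq_zero_of_mem_V (M.V.sub_mem hvV huV) ?_)
  filter_upwards [hzero, M.mem_strengthDomain_iff.1 hu, M.mem_strengthDomain_iff.1 hv,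
    M.ae_bondMeasure_of_ae (ae_scaledStrain_sub v u)] with p hp hup hvp hsub
  rw [hsub, sub_eq_zero]
  by_contra hne
  exact (bondExcess_pos hup hvp (Ne.symm hne)).ne' hp

theorem IsCriticalPoint.eq_of_isCriticalPoint (h : M.IsCriticalPoint b u)
    (h' : M.IsCriticalPoint b v) (hu : u ∈ M.strengthDomain) (hv : v ∈ M.strengthDomain)
    (huV : u ∈ M.V) (hvV : v ∈ M.V) : v = u :=
  h.eq_of_E_eq hu hv huV hvV ((h'.E_le hv hu).antisymm (h.E_le hu hv))

end CohesiveBody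

end Energy

namespace CohesiveBody

variable {d : ℕ} {M : CohesiveBody d}

theorem exists_approximatesLinearOn_L {u₀ : M.Linf} {D : M.Linf →L[ℝ] M.Linf}
    (hD : ∀ w, D w =ᵐ[M.μ] M.bondForce (M.tensionDeriv u₀ w)) {c : NNReal} (hc : 0 < c) :
    ∃ R₀ > 0, ApproximatesLinearOn M.L D (Metric.closedBall u₀ R₀) c := by
  obtain ⟨C, hC, hlip⟩ := M.exists_abs_deriv2_g_sub_le
  let B := 8 * C * ∫ z, M.bondMoment 3 z
  have hB : 0 ≤ B := mul_nonneg (by positivity) (integral_nonneg (M.bondMoment_nonneg 3))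
  refine ⟨c / (B + 1), by positivity, fun u hu v hv => ?_⟩
  refine (M.norm_L_sub_sub_le hC hlip hD (mem_closedBall_iff_norm.1 hu)
    (mem_closedBall_iff_norm.1 hv)).trans ?_
  gcongr
  change B * (c / (B + 1)) ≤ c
  rw [mul_div_left_comm]
  exact mul_le_of_le_one_right c.2 (div_le_one_of_le₀ (by linarith) (by positivity))

theorem hasFDerivAt_L {u₀ : M.Linf} {D : M.Linf →L[ℝ] M.Linf}
    (hD : ∀ w, D w =ᵐ[M.μ] M.bondForce (M.tensionDeriv u₀ w)) : HasFDerivAt M.L D u₀ := by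
  obtain ⟨C, hC, hlip⟩ := M.exists_abs_deriv2_g_sub_le
  refine hasFDerivAt_of_norm_sub_le_sq (C := 8 * C * ∫ z, M.bondMoment 3 z) fun u => ?_
  refine (M.norm_L_sub_sub_le hC hlip hD le_rfl (by simp)).trans_eq ?_
  rw [mul_assoc _ ‖u - u₀‖, ← sq]

/-- The force operator as a self-map of `M.V`, where its linearization is invertible. -/
noncomputable def restrictL (u : M.V) : M.V := ⟨M.L u, L_mem_V _⟩

theorem exists_forall_existsUnique_loadPath {u₀ : M.V} {D : M.Linf →L[ℝ] M.Linf}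
    {A : M.V ≃L[ℝ] M.V}
    (hD : ∀ w, D w =ᵐ[M.μ] M.bondForce (M.tensionDeriv (u₀ : M.Linf) w))
    (hA : ∀ w : M.V, (A w : M.Linf) = D w) :
    ∃ R₀ > 0, ∀ R, 0 ≤ R → R ≤ R₀ → ∀ {Z : Type*} [TopologicalSpace Z] (b : C(Z, M.V)),
      (∀ t, ‖b t - restrictL u₀‖ ≤ R / (2 * ‖(A.symm : M.V →L[ℝ] M.V)‖)) →
      ∃! u : C(Z, M.V), (∀ t, ‖u t - u₀‖ ≤ R) ∧ ∀ t, M.L (u t) = b t := by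
  let c : NNReal := (2 * (‖(A.symm : M.V →L[ℝ] M.V)‖₊ + 1))⁻¹
  have hc : c * ‖(A.symm : M.V →L[ℝ] M.V)‖₊ ≤ 1 / 2 := by
    rw [inv_mul_le_iff₀ (by positivity)]
    exact (le_add_of_nonneg_right zero_le_one).trans_eq (by ring)
  obtain ⟨R₀, hR₀, happrox⟩ := exists_approximatesLinearOn_L hD
    (c := c) (by positivity)
  refine ⟨R₀, hR₀, fun R hR hle Z _ b hb => ?_⟩
  have hrestrict : ApproximatesLinearOn restrictL (A : M.V →L[ℝ] M.V)
      (Metric.closedBall u₀ R) c := fun u hu v hv => by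
    have h := happrox u (Metric.closedBall_subset_closedBall hle hu) v
      (Metric.closedBall_subset_closedBall hle hv)
    rw [← AddSubgroupClass.coe_sub, ← hA] at h
    exact h
  simpa only [mem_closedBall_iff_norm, Subtype.ext_iff] using!
    existsUnique_lift_of_approximatesLinearOn hR hc hrestrict b
      fun t => mem_closedBall_iff_norm.2 (hb t)

end CohesiveBody

theorem theorem3p7_general {d : ℕ} (M : CohesiveBody d) (hcone : InteriorConeCondition M.Ω)
    (u₀ b₀ : M.V)
    (hu₀ : M.StrictlyInsideStrengthDomain u₀)
    (hcrit : M.IsCriticalPoint b₀ u₀) :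
    ∃ (D : M.Linf →L[ℝ] M.Linf) (A : M.V ≃L[ℝ] M.V),
      HasFDerivAt M.L D u₀ ∧
      (∀ w : M.V, (A w : M.Linf) = D w) ∧
      (∃ R₀ > 0, ∀ R, 0 ≤ R → R ≤ R₀ → ∀ {Z : Type*} [TopologicalSpace Z] (b : C(Z, M.V)),
        (∀ t, ‖b t - b₀‖ ≤ R / (2 * ‖(A.symm : M.V →L[ℝ] M.V)‖)) →
        ∃! u : C(Z, M.V), (∀ t, ‖u t - u₀‖ ≤ R) ∧ ∀ t, M.L (u t) = b t) ∧
      (∀ u : M.V, (u : M.Linf) ∈ M.strengthDomain → M.IsCriticalPoint b₀ u → u = u₀) ∧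
      (∀ u ∈ M.strengthDomain, M.E b₀ u₀ ≤ M.E b₀ u) ∧
      ∀ u : M.V, (u : M.Linf) ∈ M.strengthDomain → M.E b₀ u = M.E b₀ u₀ → u = u₀ := by
  obtain ⟨D, A, hD, hA⟩ := hu₀.exists_linearization hcone
  have hmem := hu₀.mem_strengthDomain
  have hLb : CohesiveBody.restrictL u₀ = b₀ := Subtype.ext hcrit.L_eq
  refine ⟨D, A, CohesiveBody.hasFDerivAt_L hD, hA, ?_, fun u hu h => ?_,
    fun u hu => hcrit.E_le hmem hu, fun u hu h => ?_⟩
  · exact hLb ▸ CohesiveBody.exists_forall_existsUnique_loadPath hD hA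
  · exact Subtype.ext (hcrit.eq_of_isCriticalPoint h hmem hu u₀.2 u.2)
  · exact Subtype.ext (hcrit.eq_of_E_eq hmem hu u₀.2 u.2 h)

theorem theorem3p7 {d : ℕ} (M : CohesiveBody d) (hcone : InteriorConeCondition M.Ω)
    (u₀ b₀ : M.V)
    (hu₀ : M.StrictlyInsideStrengthDomain u₀)
    (hcrit : M.IsCriticalPoint b₀ u₀) :
    ∃ (D : M.Linf →L[ℝ] M.Linf) (A : M.V ≃L[ℝ] M.V),
      HasFDerivAt M.L D u₀ ∧
      (∀ w : M.V, ((A w : M.V) : M.Linf) = D w) ∧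
      ∃ R₀ : ℝ, 0 < R₀ ∧ ∀ R : ℝ, 0 < R → R ≤ R₀ →
        (∀ T : ℝ, 0 ≤ T → ∀ b : C(Set.Icc (0 : ℝ) T, M.V),
          (∀ t, ‖b t - b₀‖ ≤ R / (2 * ‖(A.symm : M.V →L[ℝ] M.V)‖)) →
          ∃! u : C(Set.Icc (0 : ℝ) T, M.V),
            (∀ t, ‖u t - u₀‖ ≤ R) ∧ ∀ t, M.L (u t : M.Linf) = (b t : M.Linf)) ∧
        (∀ u : M.V, (u : M.Linf) ∈ M.strengthDomain → ‖u - u₀‖ ≤ R →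
          M.IsCriticalPoint b₀ u → u = u₀) ∧
        (∀ u : M.Linf, u ∈ M.strengthDomain → ‖u - (u₀ : M.Linf)‖ ≤ R →
          M.E b₀ u₀ ≤ M.E b₀ u) ∧
        (∀ u : M.V, (u : M.Linf) ∈ M.strengthDomain → ‖u - u₀‖ ≤ R →
          M.E b₀ u = M.E b₀ u₀ → u = u₀) := by
  obtain ⟨D, A, hD, hA, ⟨R₀, hR₀, hpath⟩, hcrit, hmin, heq⟩ :=
    theorem3p7_general M hcone u₀ b₀ hu₀ hcrit
  exact ⟨D, A, hD, hA, R₀, hR₀, fun R hR hle => ⟨fun T _ b => hpath R hR.le hle b,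
    fun u hu _ => hcrit u hu, fun u hu _ => hmin u hu, fun u hu _ => heq u hu⟩⟩
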